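/- Let $p\ge 2$ and $n\ge 1$ be integers, where $n\ge 2$ if $p$ is even. Let $U$ be a non-empty open subset of $(1+n)$-dimensional Minkowski space with coordinates $x_0,\dots,x_n$ (for example the whole space), and write $\partial_\mu=\partial/\partial x_\mu$ and $\sum_\mu{}'A_\mu=A_0-\sum_{j=1}^nA_j$. A solution of the $p$-submodel on $U$ is a smooth function $u:U\to\mathbf C$ such that $$\sum_\mu{}'\,\partial_\mu^p(u^k)=0\quad\text{on }U\qquad\text{for } 1\le k\le p .$$ The Bell matrix $B_{nj}[g]=B_{nj}(g_1,g_2,\dots)$, a polynomial in the derivatives $g_r=g^{(r)}$, is defined by $e^{-zg}\partial^n e^{zg}=\sum_j z^jB_{nj}[g]$; $B_{nj;\mu}[u]$ and $B_{nj;\mu}[\bar u]$ denote it with $g_r$ replaced by $\partial_\mu^ru$ and $\partial_\mu^r\bar u$. Let $$J_{p,\mu}=\sum_{n=0}^{p-1}\ \sum_{j\le n}\ \sum_{k\le p-1-n} f_{n,j,p-1-n,k}(u,\bar u)\,B_{nj;\mu}[u]\,B_{p-1-n,k;\mu}[\bar u]\qquad(*)$$ be a homogeneous differential polynomial of degree $p-1$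 whose coefficients $f_{n,j,p-1-n,k}$ are functions $\mathbf C\to\mathbf C$ of class $C^p$ in the real sense. (Differential polynomials are polynomials in the symbols $\partial_\mu^ru$, $\partial_\mu^r\bar u$, $r\ge1$, with functions of $(u,\bar u)$ as coefficients.) It is called a conserved current of the $p$-submodel on $U$ if $\sum_\mu{}'\partial_\mu(J_{p,\mu}[u])=0$ on $U$ for every solution $u$ on $U$. For $f=f(u,\bar u)$ of class $C^p$ put, with Wirtinger derivatives, $$V_{p,\mu}(f)=\sum_{k=0}^{p-1}(-1)^k\sum_{i\le p-1-k}\ \sum_{l\le k}\frac{\partial^{\,i+l}f}{\partial u^i\,\partial\bar u^l}\,B_{p-1-k,i;\mu}[u]\,B_{k,l;\mu}[\bar u].$$ Then $J_{p,\mu}$ is a conserved current of the $p$-submodel on $U$ if and only if there exist $f\in C^p(\mathbf C,\mathbf C)$ and a differential polynomial $K_{p,\mu}$, also of the form $(*)$ with $C^p$ coefficients, such that, as differential polynomials, $$J_{p,\mu}=V_{p,\mu}(f)+K_{p,\mu},$$ where $K_{p,\mu}$ is a conserved current of the $p$-submodel on $U$ that contains none of the principal monomials $\partial_\mu^nu\,\partial_\mu^{p-1-n}\bar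 u$, $n=0,\dots,p-1$ (for $n=0$ and $n=p-1$ this means the monomials $\partial_\mu^{p-1}\bar u$ and $\partial_\mu^{p-1}u$). In particular, for $p=2$, every such $K_{2,\mu}$ is identically $0$. -/

import Mathlib

open scoped ContDiff

noncomputable section

namespace PSubmodel

/-! ## Bell polynomials -/

/-- The shift `∑_r g_{r+1} ∂/∂g_r`, i.e. formal differentiation of polynomials in the
symbols `g_r = X r` (which stand for the derivatives `g^{(r)}` of a function `g`). -/
def shift : Derivation ℂ (MvPolynomial ℕ ℂ) (MvPolynomial ℕ ℂ) :=
  MvPolynomial.mkDerivation ℂ (fun r => MvPolynomial.X (r + 1))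

/-- The Bell matrix `B_{nj}(g_1, g_2, …)`: the coefficient of `z ^ j` in the Bell polynomial
`F_n[zg] = e^{-zg} ∂^n e^{zg} = (∂ + z g_1)^n 1`; see `iteratedDeriv_exp_eq_bell`. -/
def bell : ℕ → ℕ → MvPolynomial ℕ ℂ
  | 0, 0 => 1
  | 0, _ + 1 => 0
  | n + 1, 0 => shift (bell n 0)
  | n + 1, j + 1 => shift (bell n (j + 1)) + MvPolynomial.X 1 * bell n j

theorem hasDerivAt_eval_shift {g : ℝ → ℂ} (hg : ContDiff ℝ ∞ g) (P : MvPolynomial ℕ ℂ) (x : ℝ) :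
    HasDerivAt (fun t => MvPolynomial.eval (fun r => iteratedDeriv r g t) P)
      (MvPolynomial.eval (fun r => iteratedDeriv r g x) (shift P)) x := by
  induction P using MvPolynomial.induction_on with
  | C a => simpa using hasDerivAt_const x a
  | add P Q hP hQ =>
    simp only [map_add]
    exact hP.fun_add hQ
  | mul_X P r hP =>
    have h : HasDerivAt (iteratedDeriv r g) (iteratedDeriv (r + 1) g x) x := by
      rw [iteratedDeriv_succ]
      exact ((hg.differentiable_iteratedDeriv r (by exact_mod_cast ENat.natCast_lt_top r)) x).hasDerivAt
    have := hP.fun_mul h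
    simp only [shift, Derivation.leibniz, MvPolynomial.mkDerivation_X, map_mul, map_add,
      MvPolynomial.eval_X, smul_eq_mul] at this ⊢
    refine this.congr_deriv ?_
    ring

theorem bell_eq_zero : ∀ (n j : ℕ), n < j → bell n j = 0
  | 0, j + 1, _ => by simp [bell]
  | n + 1, j + 1, h => by
    simp [bell, bell_eq_zero n (j + 1) (by omega), bell_eq_zero n j (by omega)]

/-- The defining equation of the Bell polynomials, `F_n[zg] = e^{-zg} ∂^n e^{zg}` with
`F_n[zg] = ∑_j z^j B_{nj}(g', g'', …)`. -/
theorem iteratedDeriv_exp_eq_bell {g : ℝ → ℂ} (hg : ContDiff ℝ ∞ g) (z : ℂ) (n : ℕ) (x : ℝ) :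
    Complex.exp (-(z * g x)) * iteratedDeriv n (fun t => Complex.exp (z * g t)) x =
      ∑ j ∈ Finset.range (n + 1),
        z ^ j * MvPolynomial.eval (fun r => iteratedDeriv r g x) (bell n j) := by
  have key : ∀ n : ℕ, iteratedDeriv n (fun t => Complex.exp (z * g t)) = fun x =>
      Complex.exp (z * g x) * ∑ j ∈ Finset.range (n + 1),
        z ^ j * MvPolynomial.eval (fun r => iteratedDeriv r g x) (bell n j) := by
    intro n
    induction n with
    | zero => funext x; simp [bell]
    | succ n ih =>
      rw [iteratedDeriv_succ, ih]
      funext x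
      have h1 : HasDerivAt g (iteratedDeriv 1 g x) x := by
        rw [iteratedDeriv_one]
        exact (hg.differentiable (by simp) x).hasDerivAt
      have h2 := (h1.const_mul z).cexp
      have h3 := HasDerivAt.fun_sum (u := Finset.range (n + 1)) (fun j _ =>
        (hasDerivAt_eval_shift hg (bell n j) x).const_mul (z ^ j))
      rw [(h2.fun_mul h3).deriv, Finset.sum_range_succ' _ (n + 1)]
      simp only [bell, map_add, map_mul, MvPolynomial.eval_X, mul_add, Finset.sum_add_distrib]
      have h4 := Finset.sum_range_succ' (fun j => z ^ j *
        MvPolynomial.eval (fun r => iteratedDeriv r g x) (shift (bell n j))) (n + 1)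
      rw [Finset.sum_range_succ, bell_eq_zero n (n + 1) (by omega)] at h4
      simp only [map_zero, mul_zero, add_zero] at h4
      rw [h4]
      simp only [Finset.mul_sum, pow_succ, mul_add]
      rw [← add_assoc, add_comm (∑ _ ∈ _, _) (∑ _ ∈ _, _)]
      congr 2
      exact Finset.sum_congr rfl fun j _ => by ring
  rw [key]
  simp only
  rw [← mul_assoc, ← Complex.exp_add]
  simp

/-! ## Differential polynomials -/

/-- Differential polynomials in `u`, `ū` (in one direction `x_μ`): polynomials in the symbols
`X (inl r) = ∂_μ^r u` and `X (inr r) = ∂_μ^r ū`, whose coefficients are functions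
`f = f(u, ū)`, i.e. functions `ℂ → ℂ`. -/
abbrev DiffPoly : Type := MvPolynomial (ℕ ⊕ ℕ) (ℂ → ℂ)

/-- `B_{nj;μ}[u]`. -/
def bellU (n j : ℕ) : DiffPoly :=
  MvPolynomial.aeval (fun r => (MvPolynomial.X (Sum.inl r) : DiffPoly)) (bell n j)

/-- `B_{mk;μ}[ū]`. -/
def bellUbar (m k : ℕ) : DiffPoly :=
  MvPolynomial.aeval (fun r => (MvPolynomial.X (Sum.inr r) : DiffPoly)) (bell m k)

/-- `J` is a homogeneous differential polynomial of degree `d` with coefficients in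
`C^p(ℂ, ℂ)` (in the real sense):
`J = ∑_{n=0}^d ∑_{j≤n} ∑_{k≤d-n} f_{n,j,d-n,k}(u, ū) B_{nj;μ}[u] B_{d-n,k;μ}[ū]`. -/
def IsHomogeneousDiffPoly (p d : ℕ) (J : DiffPoly) : Prop :=
  ∃ f : ℕ → ℕ → ℕ → ℕ → ℂ → ℂ,
    (∀ n j m k, ContDiff ℝ p (f n j m k)) ∧
    J = ∑ n ∈ Finset.range (d + 1),
          ∑ j ∈ Finset.range (n + 1), ∑ k ∈ Finset.range (d - n + 1),
            MvPolynomial.C (f n j (d - n) k) * bellU n j * bellUbar (d - n) k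

/-- The Wirtinger derivative `∂f/∂u = (∂f/∂x - i ∂f/∂y) / 2`. -/
def dU (f : ℂ → ℂ) (w : ℂ) : ℂ :=
  (fderiv ℝ f w 1 - Complex.I * fderiv ℝ f w Complex.I) / 2

/-- The Wirtinger derivative `∂f/∂ū = (∂f/∂x + i ∂f/∂y) / 2`. -/
def dUbar (f : ℂ → ℂ) (w : ℂ) : ℂ :=
  (fderiv ℝ f w 1 + Complex.I * fderiv ℝ f w Complex.I) / 2

/-- The normally ordered operator `:F_{n,μ} F̄_{m,μ}:` applied to `f`, i.e.
`∑_{j,k} (∂_u^j ∂_ū^k f) B_{nj;μ}[u] B_{mk;μ}[ū]`. -/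
def normalOrdered (n m : ℕ) (f : ℂ → ℂ) : DiffPoly :=
  ∑ j ∈ Finset.range (n + 1), ∑ k ∈ Finset.range (m + 1),
    MvPolynomial.C (dU^[j] (dUbar^[k] f)) * bellU n j * bellUbar m k

/-- `V_{p,μ}(f) = ∑_{k=0}^{p-1} (-1)^k :F_{p-1-k,μ} F̄_{k,μ}: f`. -/
def V (p : ℕ) (f : ℂ → ℂ) : DiffPoly :=
  ∑ k ∈ Finset.range p, (-1) ^ k * normalOrdered (p - 1 - k) k f

/-- The exponent of the monomial `∂_μ^n u ∂_μ^m ū`, where the factor of order `0` (the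
function `u` or `ū` itself, which belongs to the coefficients) is left out. -/
def principalExponent (n m : ℕ) : (ℕ ⊕ ℕ) →₀ ℕ :=
  (if n = 0 then 0 else Finsupp.single (Sum.inl n) 1) +
    (if m = 0 then 0 else Finsupp.single (Sum.inr m) 1)

/-- `K` contains no principal part `∂_μ^n u ∂_μ^{p-1-n} ū`, `n = 0, …, p - 1`. -/
def HasNoPrincipalPart (p : ℕ) (K : DiffPoly) : Prop :=
  ∀ n < p, MvPolynomial.coeff (principalExponent n (p - 1 - n)) K = 0

/-! ## The `p`-submodel on `(1+n)`-dimensional Minkowski space -/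

/-- `(1+n)`-dimensional Minkowski space, with coordinates `x_0, …, x_n`. -/
abbrev Mink (n : ℕ) : Type := Fin (n + 1) → ℝ

/-- The Minkowski sum `∑'_μ A_μ = A_0 - ∑_{j=1}^n A_j`. -/
def minkSum {n : ℕ} (A : Fin (n + 1) → ℂ) : ℂ := A 0 - ∑ j : Fin n, A j.succ

/-- The partial derivative `∂_μ v = ∂v/∂x_μ`. -/
def pd {n : ℕ} (μ : Fin (n + 1)) (v : Mink n → ℂ) (x : Mink n) : ℂ :=
  fderiv ℝ v x (Pi.single μ 1)

/-- `u` is a smooth solution on `U` of the `p`-submodel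
`□_p (u^k) = (∂_0^p - ∑_{j=1}^n ∂_j^p) (u^k) = 0`, `1 ≤ k ≤ p`. -/
def IsSolution {n : ℕ} (p : ℕ) (U : Set (Mink n)) (u : Mink n → ℂ) : Prop :=
  ContDiffOn ℝ ∞ u U ∧
    ∀ k : ℕ, 1 ≤ k → k ≤ p → ∀ x ∈ U,
      minkSum (fun μ => ((pd μ)^[p] (fun y => u y ^ k)) x) = 0

/-- The function `J_μ[u]` on space-time: the symbols are replaced by `∂_μ^r u`, `∂_μ^r ū`, and
the coefficients are evaluated at `u`. -/
def evalAt {n : ℕ} (J : DiffPoly) (u : Mink n → ℂ) (μ : Fin (n + 1)) (x : Mink n) : ℂ :=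
  MvPolynomial.eval₂ (Pi.evalRingHom (fun _ : ℂ => ℂ) (u x))
    (Sum.elim (fun r => ((pd μ)^[r] u) x)
      (fun r => ((pd μ)^[r] (fun y => (starRingEnd ℂ) (u y))) x)) J

/-- `J_μ` is a conserved current of the `p`-submodel on `U`: `∂^μ J_μ[u] = 0` on `U` for every
solution `u` on `U`. -/
def IsConservedCurrent {n : ℕ} (p : ℕ) (U : Set (Mink n)) (J : DiffPoly) : Prop :=
  ∀ u : Mink n → ℂ, IsSolution p U u →
    ∀ x ∈ U, minkSum (fun μ => pd μ (evalAt J u μ) x) = 0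

end PSubmodel

end

open scoped ContDiff

noncomputable section

namespace PSubmodel

open ComplexConjugate

/-! ## Wirtinger calculus -/

/-! Sufficiency is a telescoping argument. The total derivative of `:F_m F̄_l: f` is `:F_{m+1} F̄_l:
f + :F_m F̄_{l+1}: f`, so the alternating sum `V p f` has derivative `:F_p: f - (-1)^p :F̄_p: f`
(`hasPD_evalAt_V`). Its Minkowski sum vanishes because the equations for `u^k`, `1 ≤ k ≤ p`, form a
triangular system equivalent to `∑' B_{pj;μ}[u] = 0` for all `j` (`minkSum_bellEval_eq_zero`).

For necessity, the current is tested on waves `w + t (e^{a·(x-x₀)} - 1)` with `∑' a_μ^p = 0`. On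
them Bell polynomials become Stirling numbers times powers. Scaling `a` by a complex number
separates the mixed sums `∑' a_μ^N (conj a_μ)^{p-N}`. A covector for which none of these vanishes
(`exists_characteristic_covector`) lets them be cancelled, and comparing powers of `t` and `conj t`
yields first-order equations for the coefficients at the point `w`.

After a change of sign, these equations say that the coefficients of `∂^{p-1} u` and `∂^{p-1} ū`
form a closed 1-form on `ℂ`, hence are `∂_u g` and `∂_ū g`. All coefficients of genuinely mixed
terms are then forced to be derivatives of `g`. The pure `u` (or `ū`) terms are fixed only up to
holomorphic (or antiholomorphic) functions (`Determining.exists_potential`). These leftovers make up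
`K`. It is conserved as a difference of conserved currents, and it has no principal part because `g`
was chosen to match the two extreme principal coefficients. -/

theorem fderiv_eq_wirtinger (f : ℂ → ℂ) (w h : ℂ) :
    fderiv ℝ f w h = dU f w * h + dUbar f w * conj h := by
  have e : h = h.re • (1 : ℂ) + h.im • Complex.I := by simp
  have e' : fderiv ℝ f w h = h.re * fderiv ℝ f w 1 + h.im * fderiv ℝ f w Complex.I := by
    conv_lhs => rw [e]
    rw [map_add, map_smul, map_smul]
    simp
  have e1 : h = h.re + h.im * Complex.I := by simp
  have e2 : conj h = h.re - h.im * Complex.I := by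
    apply Complex.ext <;> simp
  rw [e', e2]
  conv_rhs => rw [e1]
  simp only [dU, dUbar, Complex.add_re, Complex.ofReal_re, Complex.mul_re, Complex.ofReal_im,
    Complex.I_re, Complex.I_im, Complex.add_im, Complex.mul_im]
  ring_nf
  simp only [Complex.I_sq]
  ring

theorem dU_sub {f g : ℂ → ℂ} (hf : Differentiable ℝ f) (hg : Differentiable ℝ g) :
    dU (f - g) = dU f - dU g := by
  funext w
  simp only [dU, Pi.sub_apply, fderiv_sub (hf w) (hg w), sub_apply]
  ring

theorem dUbar_sub {f g : ℂ → ℂ} (hf : Differentiable ℝ f) (hg : Differentiable ℝ g) :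
    dUbar (f - g) = dUbar f - dUbar g := by
  funext w
  simp only [dUbar, Pi.sub_apply, fderiv_sub (hf w) (hg w), sub_apply]
  ring

theorem dU_const_smul (a : ℂ) (f : ℂ → ℂ) : dU (a • f) = a • dU f := by
  funext w
  simp only [dU, Pi.smul_apply, fderiv_const_smul_field, smul_apply, smul_eq_mul]
  ring

theorem dUbar_const_smul (a : ℂ) (f : ℂ → ℂ) : dUbar (a • f) = a • dUbar f := by
  funext w
  simp only [dUbar, Pi.smul_apply, fderiv_const_smul_field, smul_apply, smul_eq_mul]
  ring

theorem contDiff_dU {f : ℂ → ℂ} {n : ℕ} (hf : ContDiff ℝ (n + 1 : ℕ) f) :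
    ContDiff ℝ n (dU f) := by
  have h : ∀ v : ℂ, ContDiff ℝ n (fun w => fderiv ℝ f w v) := fun v =>
    (hf.fderiv_right (m := n) (by norm_cast)).clm_apply contDiff_const
  exact ((h 1).sub (contDiff_const.mul (h Complex.I))).div_const 2

theorem contDiff_dUbar {f : ℂ → ℂ} {n : ℕ} (hf : ContDiff ℝ (n + 1 : ℕ) f) :
    ContDiff ℝ n (dUbar f) := by
  have h : ∀ v : ℂ, ContDiff ℝ n (fun w => fderiv ℝ f w v) := fun v =>
    (hf.fderiv_right (m := n) (by norm_cast)).clm_apply contDiff_const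
  exact ((h 1).add (contDiff_const.mul (h Complex.I))).div_const 2

theorem contDiff_iterate_dU {f : ℂ → ℂ} {n j : ℕ} (hf : ContDiff ℝ (n + j : ℕ) f) :
    ContDiff ℝ n (dU^[j] f) := by
  induction j generalizing f with
  | zero => simpa using hf
  | succ j ih => exact ih (contDiff_dU hf)

theorem contDiff_iterate_dUbar {f : ℂ → ℂ} {n j : ℕ} (hf : ContDiff ℝ (n + j : ℕ) f) :
    ContDiff ℝ n (dUbar^[j] f) := by
  induction j generalizing f with
  | zero => simpa using hf
  | succ j ih => exact ih (contDiff_dUbar hf)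

theorem contDiff_iterate_dU_dUbar {f : ℂ → ℂ} {n j k : ℕ} (hf : ContDiff ℝ (n + j + k : ℕ) f) :
    ContDiff ℝ n (dU^[j] (dUbar^[k] f)) :=
  contDiff_iterate_dU (contDiff_iterate_dUbar hf)

theorem dU_dUbar_comm {f : ℂ → ℂ} (hf : ContDiff ℝ 2 f) : dU (dUbar f) = dUbar (dU f) := by
  have hd : ∀ v : ℂ, Differentiable ℝ (fun w => fderiv ℝ f w v) := fun v =>
    ((hf.fderiv_right (m := 1) (by norm_num)).clm_apply contDiff_const).differentiable (by simp)
  have hd' : Differentiable ℝ (fderiv ℝ f) :=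
    (hf.fderiv_right (m := 1) (by norm_num)).differentiable (by simp)
  have key : ∀ w v h, fderiv ℝ (fun w => fderiv ℝ f w v) w h = fderiv ℝ (fderiv ℝ f) w h v := by
    intro w v h
    rw [fderiv_clm_apply (hd' w) (differentiableAt_const v)]
    simp
  funext w
  have symm := (hf.contDiffAt (x := w)).isSymmSndFDerivAt (by simp) 1 Complex.I
  have e1 : ∀ h, fderiv ℝ (dUbar f) w h = (fderiv ℝ (fderiv ℝ f) w h 1 +
      Complex.I * fderiv ℝ (fderiv ℝ f) w h Complex.I) / 2 := by
    intro h
    have := (((hd 1 w).hasFDerivAt.add ((hd Complex.I w).hasFDerivAt.const_mul Complex.I)).mul_const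
      (2 : ℂ)⁻¹)
    rw [show dUbar f = fun w => (fderiv ℝ f w 1 + Complex.I * fderiv ℝ f w Complex.I) * 2⁻¹ from rfl]
    erw [this.fderiv]
    simp [key]
    ring
  have e2 : ∀ h, fderiv ℝ (dU f) w h = (fderiv ℝ (fderiv ℝ f) w h 1 -
      Complex.I * fderiv ℝ (fderiv ℝ f) w h Complex.I) / 2 := by
    intro h
    have := (((hd 1 w).hasFDerivAt.sub ((hd Complex.I w).hasFDerivAt.const_mul Complex.I)).mul_const
      (2 : ℂ)⁻¹)
    rw [show dU f = fun w => (fderiv ℝ f w 1 - Complex.I * fderiv ℝ f w Complex.I) * 2⁻¹ from rfl]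
    erw [this.fderiv]
    simp [key]
    ring
  rw [dU, dUbar, e1, e1, e2, e2, symm]
  ring

theorem dUbar_iterate_dU {f : ℂ → ℂ} {j : ℕ} (hf : ContDiff ℝ (j + 1 : ℕ) f) :
    dUbar (dU^[j] f) = dU^[j] (dUbar f) := by
  induction j generalizing f with
  | zero => rfl
  | succ j ih =>
    rw [Function.iterate_succ_apply, ih (contDiff_dU hf), Function.iterate_succ_apply,
      dU_dUbar_comm (hf.of_le (by norm_cast; omega))]

theorem dUbar_iterate_dU_dUbar {f : ℂ → ℂ} {j k : ℕ} (hf : ContDiff ℝ (j + k + 1 : ℕ) f) :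
    dUbar (dU^[j] (dUbar^[k] f)) = dU^[j] (dUbar^[k + 1] f) := by
  rw [dUbar_iterate_dU, Function.iterate_succ_apply']
  exact contDiff_iterate_dUbar (hf.of_le (by norm_cast; omega))

theorem dU_iterate_dUbar {f : ℂ → ℂ} {k : ℕ} (hf : ContDiff ℝ (k + 1 : ℕ) f) :
    dU (dUbar^[k] f) = dUbar^[k] (dU f) := by
  induction k generalizing f with
  | zero => rfl
  | succ k ih =>
    rw [Function.iterate_succ_apply, ih (contDiff_dUbar hf), Function.iterate_succ_apply,
      dU_dUbar_comm (hf.of_le (by norm_cast; omega))]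

/-- Vanishing of `dUbar f` is the Cauchy–Riemann equation, so `f` is entire and therefore smooth.
This restores class `C^p` to the residual coefficients, although derivatives of the potential have
lost regularity. -/
theorem contDiff_of_dUbar_eq_zero {f : ℂ → ℂ} (hf : Differentiable ℝ f) (h : dUbar f = 0)
    (n : ℕ) : ContDiff ℝ n f := by
  have hc : Differentiable ℂ f := by
    intro w
    have : HasFDerivAt f (ContinuousLinearMap.toSpanSingleton ℂ (dU f w)) w := by
      refine hasFDerivAt_of_restrictScalars ℝ (hf w).hasFDerivAt ?_
      ext1 v
      simp [fderiv_eq_wirtinger, h, mul_comm]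
    exact this.differentiableAt
  exact (hc.contDiff (n := n)).restrict_scalars ℝ

theorem contDiff_of_dU_eq_zero {f : ℂ → ℂ} (hf : Differentiable ℝ f) (h : dU f = 0)
    (n : ℕ) : ContDiff ℝ n f := by
  have e : ∀ w v, fderiv ℝ (fun w => conj (f w)) w v = conj (fderiv ℝ f w v) := by
    intro w v
    have := (Complex.conjCLE.toContinuousLinearMap.hasFDerivAt (x := f w)).comp w (hf w).hasFDerivAt
    have h2 : HasFDerivAt (fun w => conj (f w))
      (Complex.conjCLE.toContinuousLinearMap.comp (fderiv ℝ f w)) w := this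
    rw [h2.fderiv]
    rfl
  have h0 : dUbar (fun w => conj (f w)) = 0 := by
    funext w
    have := congrArg conj (congrFun h w)
    simp only [dU, map_div₀, map_sub, map_mul, Complex.conj_I, Pi.zero_apply, map_zero,
      map_ofNat] at this
    simp only [dUbar, e, Pi.zero_apply, ← this]
    ring
  have hd : Differentiable ℝ (fun w => conj (f w)) := Complex.conjCLE.differentiable.comp hf
  have := Complex.conjCLE.contDiff.comp (contDiff_of_dUbar_eq_zero hd h0 n)
  convert this using 1
  funext w
  simp

/-- A closed form `a du + b dū` on `ℂ` is exact. -/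
theorem exists_dU_dUbar_eq {a b : ℂ → ℂ} {n : ℕ} (ha : ContDiff ℝ (n + 1 : ℕ) a)
    (hb : ContDiff ℝ (n + 1 : ℕ) b) (hab : dU b = dUbar a) :
    ∃ f : ℂ → ℂ, ContDiff ℝ (n + 2 : ℕ) f ∧ dU f = a ∧ dUbar f = b := by
  -- `A z` is `y ↦ z * y` and `B z` is `y ↦ z * conj y`, so `A (a w) + B (b w)` is the form `a du +
  -- b dū`.
  let A : ℂ →L[ℝ] ℂ →L[ℝ] ℂ := ContinuousLinearMap.mul ℝ ℂ
  let B : ℂ →L[ℝ] ℂ →L[ℝ] ℂ :=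
    (ContinuousLinearMap.compL ℝ ℂ ℂ ℂ).flip Complex.conjCLE.toContinuousLinearMap ∘L A
  have hω : ContDiff ℝ (n + 1 : ℕ) (fun w => A (a w) + B (b w)) :=
    (A.contDiff.comp ha).add (B.contDiff.comp hb)
  have ha' : Differentiable ℝ a := ha.differentiable (by simp)
  have hb' : Differentiable ℝ b := hb.differentiable (by simp)
  have hd : ∀ w x y, fderiv ℝ (fun w => A (a w) + B (b w)) w x y =
      fderiv ℝ a w x * y + fderiv ℝ b w x * conj y := by
    intro w x y
    have : HasFDerivAt (fun w => A (a w) + B (b w)) (A ∘L fderiv ℝ a w + B ∘L fderiv ℝ b w) w :=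
      (A.hasFDerivAt.comp w (ha' w).hasFDerivAt).add (B.hasFDerivAt.comp w (hb' w).hasFDerivAt)
    rw [this.fderiv]
    simp [A, B]
  -- Poincaré lemma. In Wirtinger derivatives the symmetry condition reduces to `hab`.
  obtain ⟨f, hf⟩ := convex_univ.exists_forall_hasFDerivAt_of_fderiv_symmetric isOpen_univ
    (hω.differentiable (by simp)).differentiableOn (fun w _ x y => by
      rw [hd, hd]
      simp only [fderiv_eq_wirtinger, hab]
      ring)
  have hf' : fderiv ℝ f = fun w => A (a w) + B (b w) := funext fun w => (hf w trivial).fderiv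
  have hv : ∀ w v, fderiv ℝ f w v = a w * v + b w * conj v := by
    intro w v
    rw [hf']
    simp [A, B]
  refine ⟨f, ?_, ?_, ?_⟩
  · rw [show ((n + 2 : ℕ) : WithTop ℕ∞) = ((n + 1 : ℕ) : WithTop ℕ∞) + 1 by norm_cast,
      contDiff_succ_iff_fderiv]
    exact ⟨fun w => (hf w trivial).differentiableAt, by simp, hf' ▸ hω⟩
  · funext w
    simp only [dU, hv, map_one, Complex.conj_I]
    linear_combination (-(a w) + b w) / 2 * Complex.I_sq
  · funext w
    simp only [dUbar, hv, map_one, Complex.conj_I]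
    linear_combination (a w - b w) / 2 * Complex.I_sq

/-! ## Polynomials in `t` and `conj t` -/

/-- A polynomial in `t` and `conj t` that vanishes identically is zero. -/
theorem coeff_eq_zero_of_sum_pow_conj {n m : ℕ} {q : ℕ → ℕ → ℂ}
    (h : ∀ t : ℂ, ∑ d ∈ Finset.range n, ∑ e ∈ Finset.range m, q d e * t ^ d * conj t ^ e = 0)
    {d e : ℕ} (hd : d < n) (he : e < m) : q d e = 0 := by
  let F : MvPolynomial (Fin 2) ℂ → MvPolynomial (Fin 2) ℂ → MvPolynomial (Fin 2) ℂ := fun S T =>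
    ∑ d ∈ Finset.range n, ∑ e ∈ Finset.range m, MvPolynomial.C (q d e) * S ^ d * T ^ e
  -- With `t = a + i b`, the hypothesis says that a polynomial in the real variables `a`, `b`
  -- vanishes on all of `ℝ × ℝ`. Inverting the linear substitution then makes `t` and `conj t`
  -- independent variables.
  have h0 : F (.X 0 + .C Complex.I * .X 1) (.X 0 - .C Complex.I * .X 1) = 0 := by
    refine MvPolynomial.funext_set (fun _ => Set.range ((↑) : ℝ → ℂ))
      (fun _ => Set.infinite_range_of_injective Complex.ofReal_injective) fun x hx => ?_
    obtain ⟨a, ha⟩ := hx 0 trivial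
    obtain ⟨b, hb⟩ := hx 1 trivial
    simpa [F, ← ha, ← hb, sub_eq_add_neg] using h (a + Complex.I * b)
  have h1 : ∀ s t : ℂ, ∑ d ∈ Finset.range n, ∑ e ∈ Finset.range m, q d e * s ^ d * t ^ e = 0 := by
    intro s t
    have := congrArg (MvPolynomial.eval ![(s + t) / 2, -Complex.I * (s - t) / 2]) h0
    simp only [F, map_sum, map_mul, map_pow, map_add, map_sub, MvPolynomial.eval_C,
      MvPolynomial.eval_X, map_zero, Matrix.cons_val_zero, Matrix.cons_val_one] at this
    have e1 : (s + t) / 2 + Complex.I * (-Complex.I * (s - t) / 2) = s := by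
      linear_combination -(s - t) / 2 * Complex.I_sq
    have e2 : (s + t) / 2 - Complex.I * (-Complex.I * (s - t) / 2) = t := by
      linear_combination (s - t) / 2 * Complex.I_sq
    simpa only [e1, e2] using this
  have poly : ∀ (k : ℕ) (r : ℕ → ℂ), (∀ t : ℂ, ∑ i ∈ Finset.range k, r i * t ^ i = 0) →
      ∀ i < k, r i = 0 := by
    intro k r hr i hi
    have : (∑ i ∈ Finset.range k, Polynomial.C (r i) * Polynomial.X ^ i) = 0 :=
      Polynomial.funext fun t => by simpa [Polynomial.eval_finsetSum] using hr t
    have := congrArg (Polynomial.coeff · i) this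
    simpa [Polynomial.finsetSum_coeff, Polynomial.coeff_X_pow, hi] using this
  refine poly m (q d) (fun t => poly n (fun d => ∑ e ∈ Finset.range m, q d e * t ^ e)
    (fun s => ?_) d hd) e he
  rw [← h1 s t]
  refine Finset.sum_congr rfl fun d _ => ?_
  rw [Finset.sum_mul]
  exact Finset.sum_congr rfl fun e _ => by ring

theorem coeff_eq_zero_of_sum_pow_succ_conj {n m : ℕ} {q : ℕ → ℕ → ℂ}
    (h : ∀ t : ℂ, ∑ d ∈ Finset.range n, ∑ e ∈ Finset.range m,
      q d e * t ^ (d + 1) * conj t ^ (e + 1) = 0)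
    {d e : ℕ} (hd : d < n) (he : e < m) : q d e = 0 := by
  let q' : ℕ → ℕ → ℂ := fun d e => if d = 0 ∨ e = 0 then 0 else q (d - 1) (e - 1)
  have := coeff_eq_zero_of_sum_pow_conj (n := n + 1) (m := m + 1) (q := q') (fun t => by
    rw [← h t, Finset.sum_range_succ']
    simp [Finset.sum_range_succ', q']) (d := d + 1) (e := e + 1) (by omega) (by omega)
  simpa [q'] using this

theorem coeff_eq_zero_of_sum_pow_conj_homogeneous {p : ℕ} {q : ℕ → ℂ}
    (h : ∀ t : ℂ, ∑ N ∈ Finset.range (p + 1), q N * t ^ N * conj t ^ (p - N) = 0)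
    {N : ℕ} (hN : N ≤ p) : q N = 0 := by
  have := coeff_eq_zero_of_sum_pow_conj (n := p + 1) (m := p + 1)
    (q := fun d e => if e = p - d then q d else 0) (fun t => by
      refine (Finset.sum_congr rfl fun d _ => ?_).trans (h t)
      simp only [ite_mul, zero_mul, Finset.sum_ite_eq', Finset.mem_range]
      rw [if_pos (by omega)]) (d := N) (e := p - N) (by omega) (by omega)
  simpa using this

/-! ## Characteristic covectors -/

theorem exp_mul_conj_exp_pow (θ : ℝ) (N M : ℕ) :
    Complex.exp (θ * Complex.I) ^ N * conj (Complex.exp (θ * Complex.I)) ^ M =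
      Complex.exp (((N : ℂ) - M) * (θ * Complex.I)) := by
  rw [← Complex.exp_conj, ← Complex.exp_nat_mul, ← Complex.exp_nat_mul, ← Complex.exp_add]
  congr 1
  simp
  ring

/-- There is a complex covector `a` with `∑'_μ a_μ^p = 0` for which all the mixed sums
`∑'_μ a_μ^N (conj a_μ)^{p-N}`, `0 < N < p`, are non-zero. -/
theorem exists_characteristic_covector {n p : ℕ} (hp : 2 ≤ p) (hn : 2 ≤ n ∨ (n = 1 ∧ Odd p)) :
    ∃ a : Fin (n + 1) → ℂ, minkSum (fun μ => a μ ^ p) = 0 ∧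
      ∀ N M : ℕ, 0 < N → 0 < M → N + M = p → minkSum (fun μ => a μ ^ N * conj (a μ) ^ M) ≠ 0 := by
  have hp0 : (p : ℂ) ≠ 0 := by norm_cast; omega
  have hpi : (2 * Real.pi * Complex.I : ℂ) ≠ 0 := Complex.two_pi_I_ne_zero
  rcases hn with hn | ⟨rfl, hodd⟩
  · obtain ⟨n, rfl⟩ := Nat.exists_eq_add_of_le' hn
    -- Here `z^p = -1`, so the covector `(0, 1, z, 0, …)` is characteristic. Moreover `z^N (conj
    -- z)^M = -e^{2πiN/p}`, which differs from `-1` for `0 < N < p`.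
    let z : ℂ := Complex.exp ((Real.pi / p : ℝ) * Complex.I)
    refine ⟨Fin.cons 0 (Fin.cons 1 (Fin.cons z fun _ => 0)), ?_, fun N M hN hM hNM => ?_⟩
    · have : z ^ p = -1 := by
        simp only [z]
        rw [← Complex.exp_nat_mul, ← Complex.exp_pi_mul_I]
        congr 1
        push_cast
        field_simp
      have hp1 : p ≠ 0 := by omega
      simp [minkSum, Fin.sum_univ_succ, this, hp1]
    · have hN0 : N ≠ 0 := by omega
      have hM0 : M ≠ 0 := by omega
      have h1 : z ^ N * conj z ^ M = -Complex.exp (2 * Real.pi * Complex.I * (N / p)) := by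
        simp only [z]
        rw [exp_mul_conj_exp_pow, neg_eq_neg_one_mul, ← Complex.exp_pi_mul_I, ← Complex.exp_add,
          Complex.exp_eq_exp_iff_exists_int]
        refine ⟨-1, ?_⟩
        have : (M : ℂ) = p - N := by rw [← hNM]; push_cast; ring
        rw [this]
        push_cast
        field_simp
        ring
      simp only [minkSum, Fin.sum_univ_succ, Fin.cons_zero, Fin.cons_succ, h1, map_zero, map_one, one_pow]
      simp only [ne_eq, hN0, not_false_eq_true, zero_pow, zero_mul, Finset.sum_const_zero, hM0]
      intro h0
      have h2 : Complex.exp (2 * Real.pi * Complex.I * (N / p)) = 1 := by linear_combination h0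
      rw [Complex.exp_eq_one_iff] at h2
      obtain ⟨k, hk⟩ := h2
      have : (N : ℂ) = k * p := by
        field_simp at hk
        linear_combination hk
      have h3 : (N : ℤ) = k * p := by exact_mod_cast this
      have h4 : 0 < k := by
        by_contra! hk'
        nlinarith
      nlinarith
  -- Now `z^p = 1` and the covector is `(1, z)`. A mixed sum vanishes only if `p` divides `2N`,
  -- where `0 < 2N < 2p`; that forces `2N = p`, which is impossible for odd `p`.
  · let z : ℂ := Complex.exp ((2 * Real.pi / p : ℝ) * Complex.I)
    refine ⟨Fin.cons 1 (Fin.cons z fun _ => 0), ?_, fun N M hN hM hNM => ?_⟩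
    · have : z ^ p = 1 := by
        simp only [z]
        rw [← Complex.exp_nat_mul, ← Complex.exp_two_pi_mul_I]
        congr 1
        push_cast
        field_simp
      simp [minkSum, this]
    · have h1 : z ^ N * conj z ^ M = Complex.exp (2 * Real.pi * Complex.I * (2 * N / p)) := by
        simp only [z]
        rw [exp_mul_conj_exp_pow, Complex.exp_eq_exp_iff_exists_int]
        refine ⟨-1, ?_⟩
        have : (M : ℂ) = p - N := by rw [← hNM]; push_cast; ring
        rw [this]
        push_cast
        field_simp
        ring
      simp only [minkSum, Fin.sum_univ_succ, Fin.cons_zero, Fin.cons_succ, h1, map_one, one_pow]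
      simp only [mul_one, Finset.univ_eq_empty, Finset.sum_empty, add_zero]
      intro h0
      have h2 : Complex.exp (2 * Real.pi * Complex.I * (2 * N / p)) = 1 := by
        linear_combination -h0
      rw [Complex.exp_eq_one_iff] at h2
      obtain ⟨k, hk⟩ := h2
      have : (2 * N : ℂ) = k * p := by
        field_simp at hk
        linear_combination hk
      have h3 : (2 * N : ℤ) = k * p := by exact_mod_cast this
      have h4 : 0 < k := by
        by_contra! hk'
        nlinarith
      have h5 : k < 2 := by
        by_contra! hk'
        nlinarith
      obtain rfl : k = 1 := by omega
      obtain ⟨r, hr⟩ := hodd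
      omega

/-! ## Partial derivatives -/

/-- `v` is differentiable at `x` with partial derivative `∂_μ v (x) = v'`. -/
def HasPD {n : ℕ} (μ : Fin (n + 1)) (v : Mink n → ℂ) (v' : ℂ) (x : Mink n) : Prop :=
  DifferentiableAt ℝ v x ∧ pd μ v x = v'

section PD

variable {n : ℕ} {μ : Fin (n + 1)} {v w : Mink n → ℂ} {v' w' : ℂ} {x : Mink n} {U : Set (Mink n)}

theorem HasPD.add (hv : HasPD μ v v' x) (hw : HasPD μ w w' x) :
    HasPD μ (fun y => v y + w y) (v' + w') x :=
  ⟨hv.1.fun_add hw.1, by rw [← hv.2, ← hw.2, pd, fderiv_fun_add hv.1 hw.1]; rfl⟩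

theorem HasPD.sub (hv : HasPD μ v v' x) (hw : HasPD μ w w' x) :
    HasPD μ (fun y => v y - w y) (v' - w') x :=
  ⟨hv.1.fun_sub hw.1, by rw [← hv.2, ← hw.2, pd, fderiv_fun_sub hv.1 hw.1]; rfl⟩

theorem HasPD.mul (hv : HasPD μ v v' x) (hw : HasPD μ w w' x) :
    HasPD μ (fun y => v y * w y) (v' * w x + v x * w') x :=
  ⟨hv.1.fun_mul hw.1, by
    rw [← hv.2, ← hw.2, pd, fderiv_fun_mul hv.1 hw.1]
    simp only [pd, add_apply, smul_apply, smul_eq_mul]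
    ring⟩

theorem hasPD_const (c : ℂ) : HasPD μ (fun _ => c) 0 x :=
  ⟨differentiableAt_const c, by simp [pd]⟩

theorem HasPD.const_mul (c : ℂ) (hv : HasPD μ v v' x) : HasPD μ (fun y => c * v y) (c * v') x := by
  simpa using (hasPD_const c).mul hv

theorem HasPD.sum {ι : Type*} {s : Finset ι} {v : ι → Mink n → ℂ} {v' : ι → ℂ}
    (h : ∀ i ∈ s, HasPD μ (v i) (v' i) x) :
    HasPD μ (fun y => ∑ i ∈ s, v i y) (∑ i ∈ s, v' i) x := by
  induction s using Finset.cons_induction with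
  | empty => simpa using hasPD_const 0
  | cons i s hi ih =>
    simp only [Finset.sum_cons]
    exact (h i (by simp)).add (ih fun j hj => h j (by simp [hj]))

theorem HasPD.pow (hv : HasPD μ v v' x) (k : ℕ) :
    HasPD μ (fun y => v y ^ k) (k * v x ^ (k - 1) * v') x := by
  induction k with
  | zero => simpa using hasPD_const 1
  | succ k ih =>
    have := ih.mul hv
    simp only [← pow_succ] at this
    refine ⟨this.1, this.2.trans ?_⟩
    rcases k with _ | k
    · simp
    · rw [show k + 1 + 1 - 1 = k + 1 by omega, show k + 1 - 1 = k by omega]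
      push_cast
      ring

theorem HasPD.comp {c : ℂ → ℂ} (hc : Differentiable ℝ c) (hv : HasPD μ v v' x) :
    HasPD μ (fun y => c (v y)) (dU c (v x) * v' + dUbar c (v x) * conj v') x := by
  have h := (hc (v x)).hasFDerivAt.comp x hv.1.hasFDerivAt
  refine ⟨h.differentiableAt, ?_⟩
  rw [← fderiv_eq_wirtinger, ← hv.2, pd]
  erw [h.fderiv]
  rfl

theorem HasPD.congr (hU : IsOpen U) (hx : x ∈ U) (h : ∀ y ∈ U, w y = v y)
    (hv : HasPD μ v v' x) : HasPD μ w v' x := by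
  have he : w =ᶠ[nhds x] v := Filter.mem_of_superset (hU.mem_nhds hx) h
  exact ⟨hv.1.congr_of_eventuallyEq he, by rw [← hv.2, pd, he.fderiv_eq]; rfl⟩

theorem pd_conj (μ : Fin (n + 1)) (v : Mink n → ℂ) :
    pd μ (fun y => conj (v y)) = fun x => conj (pd μ v x) := by
  funext x
  have := Complex.conjCLE.comp_fderiv (f := v) (x := x)
  change fderiv ℝ (Complex.conjCLE ∘ v) x (Pi.single μ 1) = _
  rw [this]
  rfl

theorem iterate_pd_conj (μ : Fin (n + 1)) (r : ℕ) (v : Mink n → ℂ) :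
    (pd μ)^[r] (fun y => conj (v y)) = fun x => conj ((pd μ)^[r] v x) := by
  induction r with
  | zero => rfl
  | succ r ih => rw [Function.iterate_succ_apply', ih, pd_conj, Function.iterate_succ_apply']

theorem contDiffOn_iterate_pd (hU : IsOpen U) (hv : ContDiffOn ℝ ∞ v U) (r : ℕ) :
    ContDiffOn ℝ ∞ ((pd μ)^[r] v) U := by
  induction r with
  | zero => exact hv
  | succ r ih =>
    rw [Function.iterate_succ_apply']
    exact (ih.fderiv_of_isOpen hU (m := ∞) (by simp)).clm_apply contDiffOn_const

theorem hasPD_iterate_pd (hU : IsOpen U) (hv : ContDiffOn ℝ ∞ v U) (hx : x ∈ U) (r : ℕ) :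
    HasPD μ ((pd μ)^[r] v) ((pd μ)^[r + 1] v x) x :=
  ⟨((contDiffOn_iterate_pd hU hv r).differentiableOn (by simp)).differentiableAt (hU.mem_nhds hx),
    by rw [Function.iterate_succ_apply']⟩

theorem contDiffOn_conj (hv : ContDiffOn ℝ ∞ v U) : ContDiffOn ℝ ∞ (fun y => conj (v y)) U :=
  Complex.conjCLE.contDiff.comp_contDiffOn hv

theorem hasPD_eval (hU : IsOpen U) (hv : ContDiffOn ℝ ∞ v U) (hx : x ∈ U) (P : MvPolynomial ℕ ℂ) :
    HasPD μ (fun y => MvPolynomial.eval (fun r => (pd μ)^[r] v y) P)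
      (MvPolynomial.eval (fun r => (pd μ)^[r] v x) (shift P)) x := by
  induction P using MvPolynomial.induction_on with
  | C a => simpa using hasPD_const a
  | add P Q hP hQ =>
    simp only [map_add]
    exact hP.add hQ
  | mul_X P r hP =>
    have := hP.mul (hasPD_iterate_pd hU hv hx r)
    simp only [shift, Derivation.leibniz, MvPolynomial.mkDerivation_X, map_mul, map_add,
      MvPolynomial.eval_X, smul_eq_mul] at this ⊢
    convert this using 1
    ring

end PD

/-! ## Minkowski sums -/

section MinkSum

variable {n : ℕ}

theorem minkSum_add (A B : Fin (n + 1) → ℂ) :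
    minkSum (fun μ => A μ + B μ) = minkSum A + minkSum B := by
  simp only [minkSum, Finset.sum_add_distrib]
  ring

theorem minkSum_sub (A B : Fin (n + 1) → ℂ) :
    minkSum (fun μ => A μ - B μ) = minkSum A - minkSum B := by
  simp only [minkSum, Finset.sum_sub_distrib]
  ring

theorem minkSum_mul (c : ℂ) (A : Fin (n + 1) → ℂ) :
    minkSum (fun μ => c * A μ) = c * minkSum A := by
  simp only [minkSum, ← Finset.mul_sum]
  ring

theorem minkSum_sum {ι : Type*} (s : Finset ι) (A : ι → Fin (n + 1) → ℂ) :
    minkSum (fun μ => ∑ i ∈ s, A i μ) = ∑ i ∈ s, minkSum (A i) := by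
  simp only [minkSum, Finset.sum_sub_distrib]
  rw [Finset.sum_comm]

theorem conj_minkSum (A : Fin (n + 1) → ℂ) :
    conj (minkSum A) = minkSum (fun μ => conj (A μ)) := by
  simp [minkSum]

end MinkSum

/-! ## Evaluation of differential polynomials -/

/-- `B_{mj;μ}[v](x)`. -/
def bellEval {n : ℕ} (μ : Fin (n + 1)) (v : Mink n → ℂ) (m j : ℕ) (x : Mink n) : ℂ :=
  MvPolynomial.eval (fun r => (pd μ)^[r] v x) (bell m j)

theorem bell_succ_zero (n : ℕ) : bell (n + 1) 0 = 0 := by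
  induction n with
  | zero => simp [bell]
  | succ n ih => rw [bell, ih, map_zero]

/-- The Bell recursion summed against weights `φ`. Taking for `φ j` a `j`-th derivative turns the
right side into what the product and chain rules produce, so differentiation raises the order by
one. -/
theorem sum_mul_bell_succ (ev : MvPolynomial ℕ ℂ →+* ℂ) (φ : ℕ → ℂ) (m : ℕ) :
    ∑ j ∈ Finset.range (m + 2), φ j * ev (bell (m + 1) j) =
      ∑ j ∈ Finset.range (m + 1),
        (φ j * ev (shift (bell m j)) + φ (j + 1) * ev (.X 1) * ev (bell m j)) := by
  have h4 := Finset.sum_range_succ' (fun j => φ j * ev (shift (bell m j))) (m + 1)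
  rw [Finset.sum_range_succ, bell_eq_zero m (m + 1) (by omega)] at h4
  simp only [map_zero, mul_zero, add_zero] at h4
  rw [Finset.sum_add_distrib, h4, Finset.sum_range_succ']
  simp only [bell, map_add, map_mul, mul_add, Finset.sum_add_distrib]
  rw [add_right_comm]
  congr 1
  exact Finset.sum_congr rfl fun j _ => by ring

section Eval

variable {n : ℕ} {u : Mink n → ℂ} {μ : Fin (n + 1)} {x : Mink n} {U : Set (Mink n)}

/-- `evalAt` as a ring homomorphism in the differential polynomial. -/
def evalHom (u : Mink n → ℂ) (μ : Fin (n + 1)) (x : Mink n) : DiffPoly →+* ℂ :=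
  MvPolynomial.eval₂Hom (Pi.evalRingHom (fun _ : ℂ => ℂ) (u x))
    (Sum.elim (fun r => ((pd μ)^[r] u) x)
      (fun r => ((pd μ)^[r] (fun y => conj (u y))) x))

theorem evalAt_eq_evalHom (J : DiffPoly) : evalAt J u μ x = evalHom u μ x J := rfl

theorem evalHom_C (c : ℂ → ℂ) : evalHom u μ x (MvPolynomial.C c) = c (u x) := by
  simp [evalHom]

theorem evalHom_bellU (m j : ℕ) : evalHom u μ x (bellU m j) = bellEval μ u m j x := by
  rw [bellU, bellEval]
  induction bell m j using MvPolynomial.induction_on with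
  | C a => simp [evalHom, MvPolynomial.algebraMap_eq, IsScalarTower.algebraMap_apply ℂ (ℂ → ℂ) DiffPoly]
  | add P Q hP hQ => simp only [map_add, hP, hQ]
  | mul_X P r hP =>
    rw [map_mul, map_mul, hP, map_mul]
    simp [evalHom]

theorem evalHom_bellUbar (m j : ℕ) :
    evalHom u μ x (bellUbar m j) = bellEval μ (fun y => conj (u y)) m j x := by
  rw [bellUbar, bellEval]
  induction bell m j using MvPolynomial.induction_on with
  | C a => simp [evalHom, MvPolynomial.algebraMap_eq, IsScalarTower.algebraMap_apply ℂ (ℂ → ℂ) DiffPoly]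
  | add P Q hP hQ => simp only [map_add, hP, hQ]
  | mul_X P r hP =>
    rw [map_mul, map_mul, hP, map_mul]
    simp [evalHom]

theorem hasPD_mul_bellEval (hU : IsOpen U) (hu : ContDiffOn ℝ ∞ u U) (hx : x ∈ U)
    {c : ℂ → ℂ} (hc : Differentiable ℝ c) (m j l k : ℕ) :
    HasPD μ (fun y => c (u y) * bellEval μ u m j y * bellEval μ (fun y => conj (u y)) l k y)
      ((c (u x) * MvPolynomial.eval (fun r => (pd μ)^[r] u x) (shift (bell m j)) +
          dU c (u x) * pd μ u x * bellEval μ u m j x) * bellEval μ (fun y => conj (u y)) l k x +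
        bellEval μ u m j x * (c (u x) * MvPolynomial.eval
            (fun r => (pd μ)^[r] (fun y => conj (u y)) x) (shift (bell l k)) +
          dUbar c (u x) * pd μ (fun y => conj (u y)) x * bellEval μ (fun y => conj (u y)) l k x))
      x := by
  have h1 : HasPD μ (fun y => c (u y))
      (dU c (u x) * pd μ u x + dUbar c (u x) * conj (pd μ u x)) x :=
    HasPD.comp hc (hasPD_iterate_pd hU hu hx 0)
  have h2 := hasPD_eval (μ := μ) hU hu hx (bell m j)
  have h3 := hasPD_eval (μ := μ) hU (contDiffOn_conj hu) hx (bell l k)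
  have h := (h1.mul h2).mul h3
  refine ⟨h.1, h.2.trans ?_⟩
  simp only [pd_conj, bellEval]
  ring

end Eval

/-! ## The currents `V_p(f)` -/

section Current

variable {n : ℕ} {u : Mink n → ℂ} {μ : Fin (n + 1)} {x : Mink n} {U : Set (Mink n)}

/-- The chain rule splits into a `∂_u` part and a `∂_ū` part, and `sum_mul_bell_succ` absorbs each
into a Bell polynomial of the next order. The extra derivative of `f` is used to commute `∂_ū` past
the powers of `∂_u`. -/
theorem hasPD_evalAt_normalOrdered (hU : IsOpen U) (hu : ContDiffOn ℝ ∞ u U) (hx : x ∈ U)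
    {f : ℂ → ℂ} {m l : ℕ} (hf : ContDiff ℝ (m + l + 1 : ℕ) f) :
    HasPD μ (evalAt (normalOrdered m l f) u μ)
      (evalAt (normalOrdered (m + 1) l f) u μ x + evalAt (normalOrdered m (l + 1) f) u μ x) x := by
  have hc : ∀ j ∈ Finset.range (m + 1), ∀ k ∈ Finset.range (l + 1),
      Differentiable ℝ (dU^[j] (dUbar^[k] f)) := fun j hj k hk => by
    simp only [Finset.mem_range] at hj hk
    exact (contDiff_iterate_dU_dUbar (n := 1)
      (hf.of_le (by norm_cast; omega))).differentiable (by simp)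
  have hcomm : ∀ j ∈ Finset.range (m + 1), ∀ k ∈ Finset.range (l + 1),
      dUbar (dU^[j] (dUbar^[k] f)) = dU^[j] (dUbar^[k + 1] f) := fun j hj k hk => by
    simp only [Finset.mem_range] at hj hk
    exact dUbar_iterate_dU_dUbar (hf.of_le (by norm_cast; omega))
  have h := HasPD.sum (s := Finset.range (m + 1)) fun j hj =>
    HasPD.sum (s := Finset.range (l + 1)) fun k hk =>
      hasPD_mul_bellEval (μ := μ) hU hu hx (hc j hj k hk) m j l k
  have e : ∀ m l y, evalAt (normalOrdered m l f) u μ y = ∑ j ∈ Finset.range (m + 1),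
      ∑ k ∈ Finset.range (l + 1), dU^[j] (dUbar^[k] f) (u y) * bellEval μ u m j y *
        bellEval μ (fun y => conj (u y)) l k y := fun m l y => by
    simp only [evalAt_eq_evalHom, normalOrdered, map_sum, map_mul, evalHom_C, evalHom_bellU,
      evalHom_bellUbar]
  have e1 : evalAt (normalOrdered m l f) u μ = fun y => ∑ j ∈ Finset.range (m + 1),
      ∑ k ∈ Finset.range (l + 1), dU^[j] (dUbar^[k] f) (u y) * bellEval μ u m j y *
        bellEval μ (fun y => conj (u y)) l k y := funext fun y => e m l y
  rw [e1]
  refine ⟨h.1, h.2.trans ?_⟩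
  rw [e, e]
  simp only [Finset.sum_add_distrib]
  congr 1
  · rw [Finset.sum_comm, Finset.sum_comm (s := Finset.range (m + 1 + 1))]
    refine Finset.sum_congr rfl fun k hk => ?_
    simp only [← Finset.sum_mul]
    congr 1
    have := sum_mul_bell_succ (MvPolynomial.eval (fun r => (pd μ)^[r] u x))
      (fun j => dU^[j] (dUbar^[k] f) (u x)) m
    simp only [MvPolynomial.eval_X, Function.iterate_succ_apply'] at this
    exact this.symm
  · refine Finset.sum_congr rfl fun j hj => ?_
    rw [← Finset.mul_sum]
    simp only [mul_right_comm _ (bellEval μ u m j x)]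
    rw [← Finset.sum_mul, mul_comm]
    congr 1
    have := sum_mul_bell_succ (MvPolynomial.eval (fun r => (pd μ)^[r] (fun y => conj (u y)) x))
      (fun k => dU^[j] (dUbar^[k] f) (u x)) l
    simp only [MvPolynomial.eval_X, Function.iterate_one] at this
    refine (Finset.sum_congr rfl fun k hk => ?_).trans this.symm
    rw [hcomm j hj k hk, bellEval]

theorem hasPD_evalAt_V (hU : IsOpen U) (hu : ContDiffOn ℝ ∞ u U) (hx : x ∈ U)
    {f : ℂ → ℂ} {p : ℕ} (hf : ContDiff ℝ p f) :
    HasPD μ (evalAt (V p f) u μ) (evalAt (normalOrdered p 0 f) u μ x -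
      (-1) ^ p * evalAt (normalOrdered 0 p f) u μ x) x := by
  have h := HasPD.sum (s := Finset.range p) fun k hk => HasPD.const_mul ((-1) ^ k)
    (hasPD_evalAt_normalOrdered (μ := μ) hU hu hx (m := p - 1 - k) (l := k)
      (hf.of_le (by simp only [Finset.mem_range] at hk; norm_cast; omega)))
  have e : evalAt (V p f) u μ = fun y => ∑ k ∈ Finset.range p,
      (-1) ^ k * evalAt (normalOrdered (p - 1 - k) k f) u μ y := funext fun y => by
    simp only [evalAt_eq_evalHom, V, map_sum, map_mul, map_pow, map_neg, map_one]
  rw [e]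
  refine ⟨h.1, h.2.trans ?_⟩
  have tel : ∀ (G : ℕ → ℂ) (q : ℕ), ∑ k ∈ Finset.range q, (-1) ^ k * (G k + G (k + 1)) =
      G 0 - (-1) ^ q * G q := by
    intro G q
    induction q with
    | zero => simp
    | succ q ih => rw [Finset.sum_range_succ, ih]; ring
  have := tel (fun k => evalAt (normalOrdered (p - k) k f) u μ x) p
  simp only [Nat.sub_zero, Nat.sub_self] at this
  rw [← this]
  refine Finset.sum_congr rfl fun k hk => ?_
  simp only [Finset.mem_range] at hk
  rw [show p - 1 - k + 1 = p - k by omega, show p - (k + 1) = p - 1 - k by omega]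

/-- Faà di Bruno's formula for the outer function `s ↦ s^k`. The truncated exponent `k - j` is
harmless, since `k.descFactorial j = 0` for `j > k`. -/
theorem iterate_pd_pow (hU : IsOpen U) (hu : ContDiffOn ℝ ∞ u U) (k m : ℕ) :
    ∀ x ∈ U, (pd μ)^[m] (fun y => u y ^ k) x =
      ∑ j ∈ Finset.range (m + 1), k.descFactorial j * u x ^ (k - j) * bellEval μ u m j x := by
  induction m with
  | zero => intro x _; simp [bellEval, bell]
  | succ m ih =>
    intro x hx
    have h := HasPD.sum (s := Finset.range (m + 1)) fun j _ =>
      ((HasPD.pow (hasPD_iterate_pd (μ := μ) hU hu hx 0) (k - j)).const_mul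
        (k.descFactorial j : ℂ)).mul (hasPD_eval (μ := μ) hU hu hx (bell m j))
    rw [Function.iterate_succ_apply', (h.congr hU hx ih).2]
    have := sum_mul_bell_succ (MvPolynomial.eval (fun r => (pd μ)^[r] u x))
      (fun j => k.descFactorial j * u x ^ (k - j)) m
    refine Eq.trans (Finset.sum_congr rfl fun j _ => ?_) this.symm
    simp only [MvPolynomial.eval_X, Function.iterate_one, Function.iterate_zero, id,
      Nat.descFactorial_succ, Nat.sub_sub, zero_add]
    push_cast
    ring

/-- The equation for `u^j` involves only `B_{pi}` with `i ≤ j`, and `B_{pj}` enters with the factor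
`j!`. The system is triangular and is solved by strong induction. -/
theorem minkSum_bellEval_eq_zero (hU : IsOpen U) {p : ℕ} (hu : IsSolution p U u) (hx : x ∈ U)
    (hp : 1 ≤ p) (j : ℕ) : minkSum (fun μ => bellEval μ u p j x) = 0 := by
  obtain ⟨p, rfl⟩ := Nat.exists_eq_add_of_le' hp
  induction j using Nat.strong_induction_on with
  | _ j ih =>
    by_cases hj : j = 0
    · simp [hj, bellEval, bell_succ_zero, minkSum]
    by_cases hjp : p + 1 < j
    · simp [bellEval, bell_eq_zero _ _ hjp, minkSum]
    have h := hu.2 j (by omega) (by omega) x hx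
    simp only [iterate_pd_pow hU hu.1 j (p + 1) x hx, minkSum_sum, minkSum_mul] at h
    rw [Finset.sum_eq_single j] at h
    · simpa [Nat.descFactorial_self, Nat.factorial_ne_zero] using h
    · intro i _ hij
      rcases lt_or_gt_of_ne hij with hlt | hlt
      · rw [ih i hlt, mul_zero]
      · simp [Nat.descFactorial_of_lt hlt]
    · intro hj'
      simp only [Finset.mem_range] at hj'
      omega

theorem IsSolution.conj {p : ℕ} (hu : IsSolution p U u) :
    IsSolution p U (fun y => conj (u y)) := by
  refine ⟨contDiffOn_conj hu.1, fun k h1 h2 x hx => ?_⟩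
  have := congrArg (starRingEnd ℂ) (hu.2 k h1 h2 x hx)
  rw [conj_minkSum, map_zero] at this
  simp only [← map_pow, iterate_pd_conj]
  exact this

theorem isConservedCurrent_V (hU : IsOpen U) {p : ℕ} (hp : 1 ≤ p) {f : ℂ → ℂ}
    (hf : ContDiff ℝ p f) : IsConservedCurrent p U (V p f) := by
  intro u hu x hx
  simp only [(hasPD_evalAt_V hU hu.1 hx hf).2, minkSum_sub, minkSum_mul]
  have h1 : minkSum (fun μ => evalAt (normalOrdered p 0 f) u μ x) = 0 := by
    simp only [evalAt_eq_evalHom, normalOrdered, map_sum, map_mul, evalHom_C, evalHom_bellU,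
      evalHom_bellUbar, zero_add, Finset.sum_range_one]
    simp only [bellEval, bell, map_one, mul_one]
    rw [minkSum_sum]
    refine Finset.sum_eq_zero fun j _ => ?_
    rw [minkSum_mul]
    exact mul_eq_zero_of_right _ (minkSum_bellEval_eq_zero hU hu hx hp j)
  have h2 : minkSum (fun μ => evalAt (normalOrdered 0 p f) u μ x) = 0 := by
    simp only [evalAt_eq_evalHom, normalOrdered, map_sum, map_mul, evalHom_C, evalHom_bellU,
      evalHom_bellUbar, zero_add, Finset.sum_range_one]
    simp only [bellEval, bell, map_one, mul_one]
    rw [minkSum_sum]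
    refine Finset.sum_eq_zero fun j _ => ?_
    rw [minkSum_mul]
    exact mul_eq_zero_of_right _ (minkSum_bellEval_eq_zero hU hu.conj hx hp j)
  rw [h1, h2]
  simp

theorem IsHomogeneousDiffPoly.differentiableAt (hU : IsOpen U) (hu : ContDiffOn ℝ ∞ u U)
    (hx : x ∈ U) {p d : ℕ} (hp : 1 ≤ p) {J : DiffPoly} (hJ : IsHomogeneousDiffPoly p d J) :
    DifferentiableAt ℝ (evalAt J u μ) x := by
  obtain ⟨f, hf, rfl⟩ := hJ
  have h := HasPD.sum (s := Finset.range (d + 1)) fun n _ =>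
    HasPD.sum (s := Finset.range (n + 1)) fun j _ =>
    HasPD.sum (s := Finset.range (d - n + 1)) fun k _ => hasPD_mul_bellEval (μ := μ) hU hu hx
      ((hf n j (d - n) k).differentiable (by norm_cast; omega)) n j (d - n) k
  refine h.1.congr_of_eventuallyEq (Filter.Eventually.of_forall fun y => ?_)
  simp only [evalAt_eq_evalHom, map_sum, map_mul, evalHom_C, evalHom_bellU, evalHom_bellUbar]

theorem isConservedCurrent_add {p : ℕ} {J K : DiffPoly}
    (hJd : ∀ u : Mink n → ℂ, ContDiffOn ℝ ∞ u U → ∀ x ∈ U, ∀ μ,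
      DifferentiableAt ℝ (evalAt J u μ) x)
    (hKd : ∀ u : Mink n → ℂ, ContDiffOn ℝ ∞ u U → ∀ x ∈ U, ∀ μ,
      DifferentiableAt ℝ (evalAt K u μ) x)
    (hJ : IsConservedCurrent p U J) (hK : IsConservedCurrent p U K) :
    IsConservedCurrent p U (J + K) := by
  intro u hu x hx
  have h : ∀ μ, pd μ (evalAt (J + K) u μ) x = pd μ (evalAt J u μ) x + pd μ (evalAt K u μ) x := by
    intro μ
    have h1 := HasPD.add (μ := μ) ⟨hJd u hu.1 x hx μ, rfl⟩ ⟨hKd u hu.1 x hx μ, rfl⟩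
    have e : evalAt (J + K) u μ = fun y => evalAt J u μ y + evalAt K u μ y :=
      funext fun y => by simp only [evalAt_eq_evalHom, map_add]
    rw [e]
    exact h1.2
  simp only [h, minkSum_add, hJ u hu x hx, hK u hu x hx, add_zero]

theorem isConservedCurrent_sub {p : ℕ} {J K : DiffPoly}
    (hJd : ∀ u : Mink n → ℂ, ContDiffOn ℝ ∞ u U → ∀ x ∈ U, ∀ μ,
      DifferentiableAt ℝ (evalAt J u μ) x)
    (hKd : ∀ u : Mink n → ℂ, ContDiffOn ℝ ∞ u U → ∀ x ∈ U, ∀ μ,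
      DifferentiableAt ℝ (evalAt K u μ) x)
    (hJ : IsConservedCurrent p U J) (hK : IsConservedCurrent p U K) :
    IsConservedCurrent p U (J - K) := by
  intro u hu x hx
  have h : ∀ μ, pd μ (evalAt (J - K) u μ) x = pd μ (evalAt J u μ) x - pd μ (evalAt K u μ) x := by
    intro μ
    have h1 := HasPD.sub (μ := μ) ⟨hJd u hu.1 x hx μ, rfl⟩ ⟨hKd u hu.1 x hx μ, rfl⟩
    have e : evalAt (J - K) u μ = fun y => evalAt J u μ y - evalAt K u μ y :=
      funext fun y => by simp only [evalAt_eq_evalHom, map_sub]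
    rw [e]
    exact h1.2
  simp only [h, minkSum_sub, hJ u hu x hx, hK u hu x hx, sub_zero]

end Current

/-! ## Exponential solutions -/

section ExpWave

variable {n : ℕ}

/-- The exponential wave `w + t (e^{a·(x - x₀)} - 1)`. -/
def expWave (a : Fin (n + 1) → ℂ) (w t : ℂ) (x₀ x : Mink n) : ℂ :=
  w + t * (Complex.exp (∑ μ, a μ * ((x μ - x₀ μ : ℝ) : ℂ)) - 1)

variable (a : Fin (n + 1) → ℂ) (w t : ℂ) (x₀ : Mink n) (μ : Fin (n + 1))

theorem conj_expWave (x : Mink n) :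
    conj (expWave a w t x₀ x) = expWave (fun μ => conj (a μ)) (conj w) (conj t) x₀ x := by
  simp only [expWave, map_add, map_mul, map_sub, map_one, ← Complex.exp_conj, map_sum,
    Complex.conj_ofReal]

theorem expWave_self : expWave a w t x₀ x₀ = w := by simp [expWave]

theorem contDiff_expWave : ContDiff ℝ ∞ (expWave a w t x₀) := by
  have h : ∀ μ, ContDiff ℝ ∞ (fun x : Mink n => ((x μ - x₀ μ : ℝ) : ℂ)) := fun μ =>
    Complex.ofRealCLM.contDiff.comp ((contDiff_apply ℝ ℝ μ).sub contDiff_const)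
  unfold expWave
  exact contDiff_const.add (contDiff_const.mul
    ((ContDiff.sum fun μ _ => contDiff_const.mul (h μ)).cexp.sub contDiff_const))

/-- The combination `expWave - w + t` is the pure exponential `t e^{a·(x-x₀)}`, an eigenfunction of
`∂_μ` whose value at `x₀` is `t`. -/
theorem hasPD_expWave (x : Mink n) :
    HasPD μ (expWave a w t x₀) (a μ * (expWave a w t x₀ x - w + t)) x := by
  refine ⟨(contDiff_expWave a w t x₀).differentiable (by simp) x, ?_⟩
  have h : ∀ ν, HasFDerivAt (fun x : Mink n => a ν * ((x ν - x₀ ν : ℝ) : ℂ))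
      (a ν • Complex.ofRealCLM.comp (ContinuousLinearMap.proj ν)) x := fun ν =>
    (Complex.ofRealCLM.hasFDerivAt.comp x
      ((ContinuousLinearMap.proj (R := ℝ) (φ := fun _ : Fin (n + 1) => ℝ) ν).hasFDerivAt.sub_const
        (x₀ ν))).const_mul (a ν)
  have h2 := (((HasFDerivAt.fun_sum (u := Finset.univ) fun ν _ => h ν).cexp.sub_const
    1).const_mul t).const_add w
  rw [pd]
  erw [h2.fderiv]
  have h3 : ∑ ν, a ν * (((if ν = μ then 1 else 0 : ℝ)) : ℂ) = a μ := by
    simp [apply_ite (fun r : ℝ => (r : ℂ))]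
  simp only [sum_apply, smul_apply,
    ContinuousLinearMap.comp_apply, ContinuousLinearMap.proj_apply, Pi.single_apply, smul_eq_mul,
    Complex.ofRealCLM_apply, h3, expWave]
  ring

theorem hasPD_expWave_pow (j : ℕ) (x : Mink n) :
    HasPD μ (fun x => (expWave a w t x₀ x - w + t) ^ j)
      (j * a μ * (expWave a w t x₀ x - w + t) ^ j) x := by
  have h := (((hasPD_expWave a w t x₀ μ x).sub (hasPD_const w)).add (hasPD_const t)).pow j
  refine ⟨h.1, h.2.trans ?_⟩
  rcases j with _ | j
  · simp
  · rw [show j + 1 - 1 = j by omega]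
    ring

/-- On an exponential the Bell polynomials are the terms of a Touchard polynomial: the Bell
recursion becomes `S(m+1, j+1) = (j+1) S(m, j+1) + S(m, j)`. -/
theorem bellEval_expWave (m j : ℕ) (x : Mink n) :
    bellEval μ (expWave a w t x₀) m j x =
      a μ ^ m * (Nat.stirlingSecond m j * (expWave a w t x₀ x - w + t) ^ j) := by
  have hu := (contDiff_expWave a w t x₀).contDiffOn (s := Set.univ)
  induction m generalizing j x with
  | zero => rcases j with _ | j <;> simp [bellEval, bell]
  | succ m ih =>
    rcases j with _ | j
    · simp [bellEval, bell_succ_zero]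
    · have h1 := ((hasPD_eval (μ := μ) isOpen_univ hu (Set.mem_univ x) (bell m (j + 1))).2).symm
      have h2 : (fun y => MvPolynomial.eval (fun r => (pd μ)^[r] (expWave a w t x₀) y)
          (bell m (j + 1))) = fun y => a μ ^ m * (Nat.stirlingSecond m (j + 1) *
            (expWave a w t x₀ y - w + t) ^ (j + 1)) := funext fun y => ih (j + 1) y
      have h3 := ((hasPD_expWave_pow a w t x₀ μ (j + 1) x).const_mul
        (Nat.stirlingSecond m (j + 1) : ℂ)).const_mul (a μ ^ m)
      have h4 := (hasPD_expWave a w t x₀ μ x).2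
      have h5 := ih j x
      rw [h2, h3.2] at h1
      rw [bellEval] at h5
      simp only [bellEval, bell, map_add, map_mul, MvPolynomial.eval_X, Function.iterate_one]
      rw [h1, h4, h5, Nat.stirlingSecond_succ_succ]
      push_cast
      ring

theorem isSolution_expWave {p : ℕ} (U : Set (Mink n)) (ha : minkSum (fun μ => a μ ^ p) = 0) :
    IsSolution p U (expWave a w t x₀) := by
  refine ⟨(contDiff_expWave a w t x₀).contDiffOn, fun k _ _ x _ => ?_⟩
  simp only [iterate_pd_pow isOpen_univ (contDiff_expWave a w t x₀).contDiffOn k p x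
    (Set.mem_univ x), minkSum_sum, minkSum_mul]
  refine Finset.sum_eq_zero fun j _ => mul_eq_zero_of_right _ ?_
  simp only [bellEval_expWave, mul_comm (a _ ^ p), minkSum_mul, ha, mul_zero]

theorem hasPD_mul_bellEval_expWave {c : ℂ → ℂ} (hc : Differentiable ℝ c) (m j l k : ℕ) :
    HasPD μ (fun y => c (expWave a w t x₀ y) * bellEval μ (expWave a w t x₀) m j y *
        bellEval μ (fun y => conj (expWave a w t x₀ y)) l k y)
      (Nat.stirlingSecond m j * Nat.stirlingSecond l k * t ^ j * conj t ^ k *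
        ((dU c w * t + j * c w) * (a μ ^ (m + 1) * conj (a μ) ^ l) +
          (dUbar c w * conj t + k * c w) * (a μ ^ m * conj (a μ) ^ (l + 1)))) x₀ := by
  simp only [conj_expWave, bellEval_expWave]
  have h := ((HasPD.comp hc (hasPD_expWave a w t x₀ μ x₀)).mul
    (((hasPD_expWave_pow a w t x₀ μ j x₀).const_mul
      (Nat.stirlingSecond m j : ℂ)).const_mul (a μ ^ m))).mul
    (((hasPD_expWave_pow (fun μ => conj (a μ)) (conj w) (conj t) x₀ μ k x₀).const_mul
      (Nat.stirlingSecond l k : ℂ)).const_mul (conj (a μ) ^ l))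
  refine ⟨h.1, h.2.trans ?_⟩
  simp only [expWave_self, sub_self, zero_add, map_mul]
  ring

end ExpWave

/-! ## The determining equations of a conserved current -/

section Determining

variable {n p d : ℕ} {U : Set (Mink n)} {f : ℕ → ℕ → ℕ → ℕ → ℂ → ℂ}

/-- The `u`-part of the total derivative of the part of bidegree `(m, l)`, on exponential waves. -/
def divU (f : ℕ → ℕ → ℕ → ℕ → ℂ → ℂ) (w t : ℂ) (m l : ℕ) : ℂ :=
  ∑ j ∈ Finset.range (m + 1), ∑ k ∈ Finset.range (l + 1),
    Nat.stirlingSecond m j * Nat.stirlingSecond l k * t ^ j * conj t ^ k *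
      (dU (f m j l k) w * t + j * f m j l k w)

/-- The `ū`-part of the total derivative of the part of bidegree `(m, l)`, on exponential
waves. -/
def divUbar (f : ℕ → ℕ → ℕ → ℕ → ℂ → ℂ) (w t : ℂ) (m l : ℕ) : ℂ :=
  ∑ j ∈ Finset.range (m + 1), ∑ k ∈ Finset.range (l + 1),
    Nat.stirlingSecond m j * Nat.stirlingSecond l k * t ^ j * conj t ^ k *
      (dUbar (f m j l k) w * conj t + k * f m j l k w)

theorem IsConservedCurrent.sum_divU_add_divUbar (hU : U.Nonempty)
    (hf : ∀ n j m k, Differentiable ℝ (f n j m k))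
    (hJ : IsConservedCurrent p U (∑ n ∈ Finset.range (d + 1),
      ∑ j ∈ Finset.range (n + 1), ∑ k ∈ Finset.range (d - n + 1),
        MvPolynomial.C (f n j (d - n) k) * bellU n j * bellUbar (d - n) k))
    (a : Fin (n + 1) → ℂ) (ha : minkSum (fun μ => a μ ^ p) = 0) (w t : ℂ) :
    ∑ m ∈ Finset.range (d + 1),
      (divU f w t m (d - m) * minkSum (fun μ => a μ ^ (m + 1) * conj (a μ) ^ (d - m)) +
        divUbar f w t m (d - m) * minkSum (fun μ => a μ ^ m * conj (a μ) ^ (d - m + 1))) = 0 := by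
  obtain ⟨x₀, hx₀⟩ := hU
  have h := hJ _ (isSolution_expWave a w t x₀ U ha) x₀ hx₀
  have hpd := fun μ => HasPD.sum (s := Finset.range (d + 1)) fun m _ =>
    HasPD.sum (s := Finset.range (m + 1)) fun j _ =>
    HasPD.sum (s := Finset.range (d - m + 1)) fun k _ =>
      hasPD_mul_bellEval_expWave a w t x₀ μ (hf m j (d - m) k) m j (d - m) k
  have e : ∀ μ, evalAt (∑ n ∈ Finset.range (d + 1),
      ∑ j ∈ Finset.range (n + 1), ∑ k ∈ Finset.range (d - n + 1),
        MvPolynomial.C (f n j (d - n) k) * bellU n j * bellUbar (d - n) k) (expWave a w t x₀) μ =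
      fun y => ∑ m ∈ Finset.range (d + 1),
      ∑ j ∈ Finset.range (m + 1), ∑ k ∈ Finset.range (d - m + 1),
        f m j (d - m) k (expWave a w t x₀ y) * bellEval μ (expWave a w t x₀) m j y *
          bellEval μ (fun y => conj (expWave a w t x₀ y)) (d - m) k y := fun μ => funext fun y => by
    simp only [evalAt_eq_evalHom, map_sum, map_mul, evalHom_C, evalHom_bellU, evalHom_bellUbar]
  simp only [e, (hpd _).2, minkSum_sum, minkSum_mul, minkSum_add] at h
  rw [← h]
  refine Finset.sum_congr rfl fun m _ => ?_
  simp only [divU, divUbar, Finset.sum_mul, ← Finset.sum_add_distrib]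
  refine Finset.sum_congr rfl fun j _ => Finset.sum_congr rfl fun k _ => ?_
  ring

/-- Replacing `a` by `z a` multiplies the mixed sum of type `(N, d+1-N)` by `z^N (conj z)^{d+1-N}`,
so each `N` can be isolated. For `0 < N < d+1` the mixed sum is non-zero and cancels. -/
theorem IsConservedCurrent.divU_add_divUbar (hp : 2 ≤ d + 1) (hn : 2 ≤ n ∨ (n = 1 ∧ Odd (d + 1)))
    (hU : U.Nonempty) (hf : ∀ n j m k, Differentiable ℝ (f n j m k))
    (hJ : IsConservedCurrent (d + 1) U (∑ n ∈ Finset.range (d + 1),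
      ∑ j ∈ Finset.range (n + 1), ∑ k ∈ Finset.range (d - n + 1),
        MvPolynomial.C (f n j (d - n) k) * bellU n j * bellUbar (d - n) k))
    {m l : ℕ} (hml : m + l + 1 = d) (w t : ℂ) :
    divU f w t m (l + 1) + divUbar f w t (m + 1) l = 0 := by
  obtain ⟨a, ha, hA⟩ := exists_characteristic_covector hp hn
  let A : ℕ → ℂ := fun N => minkSum (fun μ => a μ ^ N * conj (a μ) ^ (d + 1 - N))
  -- The bidegree `(m, d-m)` contributes to `N = m+1` through its `u`-part and to `N = m` through
  -- its `ū`-part. Hence `G` is void at `N = 0` and `H` at `N = d+1`.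
  let G : ℕ → ℂ := fun N => if N = 0 then 0 else divU f w t (N - 1) (d - (N - 1)) * A N
  let H : ℕ → ℂ := fun N => if N = d + 1 then 0 else divUbar f w t N (d - N) * A N
  have key := coeff_eq_zero_of_sum_pow_conj_homogeneous (p := d + 1) (q := fun N => G N + H N)
    (fun z => by
      have h := hJ.sum_divU_add_divUbar hU hf (fun μ => z * a μ) (by
        simp only [mul_pow, minkSum_mul, ha, mul_zero]) w t
      have hs : ∀ N M, minkSum (fun μ => (z * a μ) ^ N * conj (z * a μ) ^ M) =
          z ^ N * conj z ^ M * minkSum (fun μ => a μ ^ N * conj (a μ) ^ M) := fun N M => by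
        rw [← minkSum_mul]
        congr 1
        funext μ
        simp only [mul_pow, map_mul]
        ring
      simp only [hs] at h
      simp only [add_mul, Finset.sum_add_distrib]
      rw [Finset.sum_add_distrib] at h
      rw [← h, Finset.sum_range_succ', Finset.sum_range_succ (fun N => H N * _ * _)]
      simp only [G, H, if_true, zero_mul, add_zero]
      congr 1
      · refine Finset.sum_congr rfl fun N hN => ?_
        rw [if_neg (by omega), show N + 1 - 1 = N by omega, show d + 1 - (N + 1) = d - N by omega]
        simp only [A, show d + 1 - (N + 1) = d - N by omega]
        ring
      · refine Finset.sum_congr rfl fun N hN => ?_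
        simp only [Finset.mem_range] at hN
        rw [if_neg (by omega), show d + 1 - N = d - N + 1 by omega]
        simp only [A, show d + 1 - N = d - N + 1 by omega]
        ring) (N := m + 1) (by omega)
  have hA' : A (m + 1) ≠ 0 := hA _ _ (by omega) (by omega) (by omega)
  simp only [G, H] at key
  rw [if_neg (by omega), if_neg (by omega), show d - (m + 1 - 1) = l + 1 by omega,
    show d - (m + 1) = l by omega, show m + 1 - 1 = m by omega, ← add_mul] at key
  exact (mul_eq_zero.1 key).resolve_right hA'

theorem sum_stirlingSecond_mul (m : ℕ) (α β : ℕ → ℂ) (t : ℂ) :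
    ∑ j ∈ Finset.range (m + 1), Nat.stirlingSecond m j * t ^ j * (α j * t + j * β j) =
      ∑ j ∈ Finset.range (m + 1), (Nat.stirlingSecond m j * α j +
        (j + 1) * Nat.stirlingSecond m (j + 1) * β (j + 1)) * t ^ (j + 1) := by
  have h := Finset.sum_range_succ' (fun j : ℕ => (Nat.stirlingSecond m j : ℂ) * t ^ j * (j * β j))
    (m + 1)
  rw [Finset.sum_range_succ, Nat.stirlingSecond_eq_zero_of_lt (Nat.lt_succ_self m)] at h
  simp only [Nat.cast_zero, zero_mul, mul_zero, add_zero] at h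
  simp only [mul_add (_ * _ : ℂ), Finset.sum_add_distrib, h]
  rw [← Finset.sum_add_distrib]
  exact Finset.sum_congr rfl fun j _ => by push_cast; ring

theorem sum_stirlingSecond_succ (m : ℕ) (g : ℕ → ℂ) :
    ∑ j ∈ Finset.range (m + 2), Nat.stirlingSecond (m + 1) j * g j =
      ∑ j ∈ Finset.range (m + 1), Nat.stirlingSecond (m + 1) (j + 1) * g (j + 1) := by
  simp [Finset.sum_range_succ' _ (m + 1)]

theorem divU_eq (w t : ℂ) (m l : ℕ) : divU f w t m (l + 1) =
    ∑ j ∈ Finset.range (m + 1), ∑ k ∈ Finset.range (l + 1),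
      Nat.stirlingSecond (l + 1) (k + 1) * (Nat.stirlingSecond m j * dU (f m j (l + 1) (k + 1)) w +
        (j + 1) * Nat.stirlingSecond m (j + 1) * f m (j + 1) (l + 1) (k + 1) w) *
          t ^ (j + 1) * conj t ^ (k + 1) := by
  rw [divU, Finset.sum_comm, Finset.sum_comm (s := Finset.range (m + 1))]
  have h := sum_stirlingSecond_succ l fun k => conj t ^ k * ∑ j ∈ Finset.range (m + 1),
    Nat.stirlingSecond m j * t ^ j * (dU (f m j (l + 1) k) w * t + j * f m j (l + 1) k w)
  have h2 := fun k => sum_stirlingSecond_mul m (fun j => dU (f m j (l + 1) k) w)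
    (fun j => f m j (l + 1) k w) t
  refine Eq.trans (Finset.sum_congr rfl fun k _ => ?_) (h.trans (Finset.sum_congr rfl fun k _ => ?_))
  · simp only [Finset.mul_sum]
    exact Finset.sum_congr rfl fun j _ => by ring
  · rw [h2]
    simp only [Finset.mul_sum]
    exact Finset.sum_congr rfl fun j _ => by ring

theorem divUbar_eq (w t : ℂ) (m l : ℕ) : divUbar f w t (m + 1) l =
    ∑ j ∈ Finset.range (m + 1), ∑ k ∈ Finset.range (l + 1),
      Nat.stirlingSecond (m + 1) (j + 1) * (Nat.stirlingSecond l k * dUbar (f (m + 1) (j + 1) l k) w +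
        (k + 1) * Nat.stirlingSecond l (k + 1) * f (m + 1) (j + 1) l (k + 1) w) *
          t ^ (j + 1) * conj t ^ (k + 1) := by
  rw [divUbar]
  have h := sum_stirlingSecond_succ m fun j => t ^ j * ∑ k ∈ Finset.range (l + 1),
    Nat.stirlingSecond l k * conj t ^ k *
      (dUbar (f (m + 1) j l k) w * conj t + k * f (m + 1) j l k w)
  have h2 := fun j => sum_stirlingSecond_mul l (fun k => dUbar (f (m + 1) j l k) w)
    (fun k => f (m + 1) j l k w) (conj t)
  refine Eq.trans (Finset.sum_congr rfl fun k _ => ?_) (h.trans (Finset.sum_congr rfl fun k _ => ?_))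
  · simp only [Finset.mul_sum]
    exact Finset.sum_congr rfl fun j _ => by ring
  · rw [h2]
    simp only [Finset.mul_sum]
    exact Finset.sum_congr rfl fun j _ => by ring

/-- The determining equations for the coefficients of a conserved current. -/
theorem IsConservedCurrent.determining_equation (hp : 2 ≤ d + 1)
    (hn : 2 ≤ n ∨ (n = 1 ∧ Odd (d + 1)))
    (hU : U.Nonempty) (hf : ∀ n j m k, Differentiable ℝ (f n j m k))
    (hJ : IsConservedCurrent (d + 1) U (∑ n ∈ Finset.range (d + 1),
      ∑ j ∈ Finset.range (n + 1), ∑ k ∈ Finset.range (d - n + 1),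
        MvPolynomial.C (f n j (d - n) k) * bellU n j * bellUbar (d - n) k))
    {m l : ℕ} (hml : m + l + 1 = d) {j k : ℕ} (hj : j ≤ m) (hk : k ≤ l) (w : ℂ) :
    (Nat.stirlingSecond (l + 1) (k + 1) : ℂ) *
        (Nat.stirlingSecond m j * dU (f m j (l + 1) (k + 1)) w +
          (j + 1) * Nat.stirlingSecond m (j + 1) * f m (j + 1) (l + 1) (k + 1) w) +
      Nat.stirlingSecond (m + 1) (j + 1) *
        (Nat.stirlingSecond l k * dUbar (f (m + 1) (j + 1) l k) w +
          (k + 1) * Nat.stirlingSecond l (k + 1) * f (m + 1) (j + 1) l (k + 1) w) = 0 := by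
  refine coeff_eq_zero_of_sum_pow_succ_conj (n := m + 1) (m := l + 1) (q := fun j k =>
    (Nat.stirlingSecond (l + 1) (k + 1) : ℂ) *
        (Nat.stirlingSecond m j * dU (f m j (l + 1) (k + 1)) w +
          (j + 1) * Nat.stirlingSecond m (j + 1) * f m (j + 1) (l + 1) (k + 1) w) +
      Nat.stirlingSecond (m + 1) (j + 1) *
        (Nat.stirlingSecond l k * dUbar (f (m + 1) (j + 1) l k) w +
          (k + 1) * Nat.stirlingSecond l (k + 1) * f (m + 1) (j + 1) l (k + 1) w))
    (fun t => ?_) (Nat.lt_succ_of_le hj) (Nat.lt_succ_of_le hk)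
  have h := hJ.divU_add_divUbar hp hn hU hf hml w t
  rw [divU_eq, divUbar_eq, ← Finset.sum_add_distrib] at h
  rw [← h]
  refine Finset.sum_congr rfl fun j _ => ?_
  rw [← Finset.sum_add_distrib]
  exact Finset.sum_congr rfl fun k _ => by ring

end Determining

/-! ## Solution of the determining equations -/

theorem stirlingSecond_ne_zero {n k : ℕ} (h1 : 1 ≤ k) (h2 : k ≤ n) : Nat.stirlingSecond n k ≠ 0 := by
  induction n generalizing k with
  | zero => omega
  | succ n ih =>
    obtain ⟨k, rfl⟩ := Nat.exists_eq_add_of_le' h1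
    rw [Nat.stirlingSecond_succ_succ]
    rcases Nat.lt_or_ge n (k + 1) with h | h
    · obtain rfl : n = k := by omega
      simp [Nat.stirlingSecond_self]
    · have := ih (k := k + 1) (by omega) h
      positivity

theorem le_of_stirlingSecond_ne_zero {n k : ℕ} (h : Nat.stirlingSecond n k ≠ 0) : k ≤ n := by
  by_contra! hk
  exact h (Nat.stirlingSecond_eq_zero_of_lt hk)

/-- The determining equations, with the sign `(-1)^l` absorbed into the coefficients. -/
def Determining (d : ℕ) (c : ℕ → ℕ → ℕ → ℕ → ℂ → ℂ) : Prop :=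
  ∀ m l, m + l + 1 = d → ∀ j ≤ m, ∀ k ≤ l, ∀ w : ℂ,
    (Nat.stirlingSecond (l + 1) (k + 1) : ℂ) *
        (Nat.stirlingSecond m j * dU (c m j (l + 1) (k + 1)) w +
          (j + 1) * Nat.stirlingSecond m (j + 1) * c m (j + 1) (l + 1) (k + 1) w) =
      Nat.stirlingSecond (m + 1) (j + 1) *
        (Nat.stirlingSecond l k * dUbar (c (m + 1) (j + 1) l k) w +
          (k + 1) * Nat.stirlingSecond l (k + 1) * c (m + 1) (j + 1) l (k + 1) w)

section Determining

variable {d : ℕ} {c : ℕ → ℕ → ℕ → ℕ → ℂ → ℂ}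

/-- Coefficients multiplying a vanishing Bell polynomial are arbitrary. The Stirling factor is zero
there, so nothing needs to be known about them. -/
theorem stirlingSecond_mul_congr {n k : ℕ} {x y : ℂ} (h : Nat.stirlingSecond n k ≠ 0 → x = y) :
    (Nat.stirlingSecond n k : ℂ) * x = Nat.stirlingSecond n k * y := by
  by_cases hs : Nat.stirlingSecond n k = 0
  · simp [hs]
  · rw [h hs]

/-- At `j = 0` the factor `S(m+1, 0) = 0` kills the `dU` term. What remains is a recursion in `l`
with the weights of the Stirling recursion, started from `c d 1 0 0`. -/
theorem Determining.coeff_one (hc : Determining d c) (l m : ℕ) (hml : m + 1 + l = d) (k : ℕ)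
    (hk : Nat.stirlingSecond l k ≠ 0) : c (m + 1) 1 l k = dUbar^[k] (c d 1 0 0) := by
  induction l generalizing m k with
  | zero =>
    obtain rfl : k = 0 := by simpa using le_of_stirlingSecond_ne_zero hk
    obtain rfl : m + 1 = d := by omega
    rfl
  | succ l ih =>
    rcases k with _ | k
    · simp at hk
    have hkl := le_of_stirlingSecond_ne_zero hk
    funext w
    have h := hc (m + 1) l (by omega) 0 (by omega) k (by omega) w
    have h1 : (Nat.stirlingSecond l k : ℂ) * dUbar (c (m + 2) 1 l k) w =
        Nat.stirlingSecond l k * dUbar^[k + 1] (c d 1 0 0) w :=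
      stirlingSecond_mul_congr fun hs => by
        rw [ih (m + 1) (by omega) k hs, Function.iterate_succ_apply']
    have h2 : (Nat.stirlingSecond l (k + 1) : ℂ) * c (m + 2) 1 l (k + 1) w =
        Nat.stirlingSecond l (k + 1) * dUbar^[k + 1] (c d 1 0 0) w :=
      stirlingSecond_mul_congr fun hs => by rw [ih (m + 1) (by omega) (k + 1) hs]
    have hs : (Nat.stirlingSecond (l + 1) (k + 1) : ℂ) ≠ 0 := by exact_mod_cast hk
    refine mul_left_cancel₀ hs ?_
    simp only [zero_add, Nat.stirlingSecond_one_right, Nat.stirlingSecond_succ_zero] at h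
    push_cast at h
    rw [Nat.stirlingSecond_succ_succ] at h ⊢
    push_cast at h ⊢
    linear_combination h + h1 + (k + 1 : ℂ) * h2

/-- At `m = 0` the undifferentiated term carries `S(0, 1) = 0`, so only the `dU` derivative is
determined. The case `k = 0` is the closedness that yields the potential. -/
theorem Determining.dU_coeff_zero (hc : Determining (d + 1) c) {k : ℕ} (hk : k ≤ d) :
    dU (c 0 0 (d + 1) (k + 1)) = dUbar^[k + 1] (c (d + 1) 1 0 0) := by
  funext w
  have h := hc 0 d (by omega) 0 le_rfl k hk w
  have h1 : (Nat.stirlingSecond d k : ℂ) * dUbar (c 1 1 d k) w =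
      Nat.stirlingSecond d k * dUbar^[k + 1] (c (d + 1) 1 0 0) w :=
    stirlingSecond_mul_congr fun hs => by
      rw [hc.coeff_one d 0 (by omega) k hs, Function.iterate_succ_apply']
  have h2 : (Nat.stirlingSecond d (k + 1) : ℂ) * c 1 1 d (k + 1) w =
      Nat.stirlingSecond d (k + 1) * dUbar^[k + 1] (c (d + 1) 1 0 0) w :=
    stirlingSecond_mul_congr fun hs => by rw [hc.coeff_one d 0 (by omega) (k + 1) hs]
  have hs : (Nat.stirlingSecond (d + 1) (k + 1) : ℂ) ≠ 0 := by
    exact_mod_cast stirlingSecond_ne_zero (by omega) (by omega)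
  refine mul_left_cancel₀ hs ?_
  simp only [zero_add, Nat.stirlingSecond_one_right, Nat.stirlingSecond_zero,
    Nat.stirlingSecond_zero_succ] at h
  push_cast at h
  rw [Nat.stirlingSecond_succ_succ] at h ⊢
  push_cast at h ⊢
  linear_combination h + h1 + (k + 1 : ℂ) * h2

theorem Determining.reduced (hc : Determining d c) {g : ℂ → ℂ} {m : ℕ}
    (hm : ∀ l, 1 ≤ l → m + l = d → ∀ j k, Nat.stirlingSecond m j ≠ 0 →
      Nat.stirlingSecond l k ≠ 0 → c m j l k = dU^[j] (dUbar^[k] g))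
    {l : ℕ} (hml : m + 1 + l = d) {j k : ℕ} (hj : j ≤ m) (hk : k ≤ l) (w : ℂ) :
    (Nat.stirlingSecond (l + 1) (k + 1) : ℂ) * dU^[j + 1] (dUbar^[k + 1] g) w =
      Nat.stirlingSecond l k * dUbar (c (m + 1) (j + 1) l k) w +
        (k + 1) * Nat.stirlingSecond l (k + 1) * c (m + 1) (j + 1) l (k + 1) w := by
  have h := hc m l (by omega) j hj k hk w
  have hsl : Nat.stirlingSecond (l + 1) (k + 1) ≠ 0 := stirlingSecond_ne_zero (by omega) (by omega)
  have h1 : (Nat.stirlingSecond m j : ℂ) * dU (c m j (l + 1) (k + 1)) w =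
      Nat.stirlingSecond m j * dU^[j + 1] (dUbar^[k + 1] g) w :=
    stirlingSecond_mul_congr fun hs => by
      rw [hm (l + 1) (by omega) (by omega) j (k + 1) hs hsl, ← Function.iterate_succ_apply' dU]
  have h2 : (Nat.stirlingSecond m (j + 1) : ℂ) * c m (j + 1) (l + 1) (k + 1) w =
      Nat.stirlingSecond m (j + 1) * dU^[j + 1] (dUbar^[k + 1] g) w :=
    stirlingSecond_mul_congr fun hs => by
      rw [hm (l + 1) (by omega) (by omega) (j + 1) (k + 1) hs hsl]
  have hs : (Nat.stirlingSecond (m + 1) (j + 1) : ℂ) ≠ 0 := by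
    exact_mod_cast stirlingSecond_ne_zero (by omega) (by omega)
  refine mul_left_cancel₀ hs ?_
  rw [← h, Nat.stirlingSecond_succ_succ m]
  push_cast
  linear_combination (-(Nat.stirlingSecond (l + 1) (k + 1) : ℂ)) * (h1 + (j + 1 : ℂ) * h2)

/-- Row by row in `m`, starting from `coeff_one`. Within a row, `reduced` is solved for its `S(l,
k+1)` term by induction on `k`. At `l = 0` that term is absent, which is why the edge coefficients
keep a holomorphic freedom. -/
theorem Determining.coeff_middle (hc : Determining d c) {g : ℂ → ℂ}
    (hg : ContDiff ℝ (d + 1 : ℕ) g) (ha : dU g = c d 1 0 0) (m : ℕ) :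
    ∀ l, 1 ≤ l → m + 1 + l = d → ∀ j k, Nat.stirlingSecond (m + 1) j ≠ 0 →
      Nat.stirlingSecond l k ≠ 0 → c (m + 1) j l k = dU^[j] (dUbar^[k] g) := by
  induction m with
  | zero =>
    intro l hl hml j k hj hk
    have h1 := le_of_stirlingSecond_ne_zero hj
    have hkl := le_of_stirlingSecond_ne_zero hk
    rcases j with _ | j
    · simp at hj
    obtain rfl : j = 0 := by omega
    rw [hc.coeff_one l 0 hml k hk, ← ha, ← dU_iterate_dUbar (hg.of_le (by norm_cast; omega))]
    rfl
  | succ m ih =>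
    intro l hl hml j k hj hk
    have hjm := le_of_stirlingSecond_ne_zero hj
    rcases j with _ | j
    · simp at hj
    induction k with
    | zero =>
      obtain ⟨l, rfl⟩ := Nat.exists_eq_add_of_le' hl
      simp at hk
    | succ k ihk =>
      have hkl := le_of_stirlingSecond_ne_zero hk
      funext w
      have h := hc.reduced ih hml (j := j) (k := k) (by omega) (by omega) w
      have h1 : (Nat.stirlingSecond l k : ℂ) * dUbar (c (m + 1 + 1) (j + 1) l k) w =
          Nat.stirlingSecond l k * dU^[j + 1] (dUbar^[k + 1] g) w :=
        stirlingSecond_mul_congr fun hs => by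
          rw [ihk hs, dUbar_iterate_dU_dUbar (hg.of_le (by norm_cast; omega))]
      have hs : (Nat.stirlingSecond l (k + 1) : ℂ) ≠ 0 := by exact_mod_cast hk
      have hk1 : (k + 1 : ℂ) ≠ 0 := by exact_mod_cast Nat.succ_ne_zero k
      refine mul_left_cancel₀ (mul_ne_zero hk1 hs) ?_
      rw [Nat.stirlingSecond_succ_succ l] at h
      push_cast at h
      linear_combination -h - h1

theorem Determining.dUbar_coeff (hc : Determining (d + 1) c) {g : ℂ → ℂ}
    (hg : ContDiff ℝ (d + 2 : ℕ) g) (ha : dU g = c (d + 1) 1 0 0) (hb : dUbar g = c 0 0 (d + 1) 1)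
    {j : ℕ} (hj : j ≤ d) : dUbar (c (d + 1) (j + 1) 0 0) = dU^[j + 1] (dUbar g) := by
  rcases d with _ | d
  · obtain rfl : j = 0 := by omega
    have := hc.dU_coeff_zero (k := 0) le_rfl
    rw [Function.iterate_one] at this
    rw [← this, hb]
    rfl
  · funext w
    simpa [Nat.stirlingSecond_self] using (hc.reduced (hc.coeff_middle hg ha d) (l := 0) (by omega) hj le_rfl w).symm

/-- The potential comes from the closed form with the two extreme coefficients. Each edge
coefficient differs from the matching derivative of `g` by a function annihilated by `dUbar` or
`dU`, so the difference is smooth. -/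
theorem Determining.exists_potential (hc : Determining (d + 1) c)
    (hcd : ∀ n j m k, ContDiff ℝ (d + 2 : ℕ) (c n j m k)) :
    ∃ g : ℂ → ℂ, ContDiff ℝ (d + 2 : ℕ) g ∧ dU g = c (d + 1) 1 0 0 ∧ dUbar g = c 0 0 (d + 1) 1 ∧
      (∀ m l, m + 1 + (l + 1) = d + 1 → ∀ j ≤ m, ∀ k ≤ l,
        c (m + 1) (j + 1) (l + 1) (k + 1) = dU^[j + 1] (dUbar^[k + 1] g)) ∧
      (∀ j ≤ d, ContDiff ℝ (d + 2 : ℕ) (c (d + 1) (j + 1) 0 0 - dU^[j + 1] g)) ∧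
      (∀ k ≤ d, ContDiff ℝ (d + 2 : ℕ) (c 0 0 (d + 1) (k + 1) - dUbar^[k + 1] g)) := by
  have h0 := hc.dU_coeff_zero (k := 0) (Nat.zero_le d)
  rw [zero_add, Function.iterate_one] at h0
  obtain ⟨g, hg, ha, hb⟩ := exists_dU_dUbar_eq (hcd (d + 1) 1 0 0) (hcd 0 0 (d + 1) 1) h0
  have hg' : ContDiff ℝ (d + 2 : ℕ) g := hg.of_le (by norm_cast; omega)
  refine ⟨g, hg', ha, hb, fun m l hml j hj k hk => ?_, fun j hj => ?_, fun k hk => ?_⟩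
  · exact hc.coeff_middle hg' ha m (l + 1) (by omega) hml (j + 1) (k + 1)
      (stirlingSecond_ne_zero (by omega) (by omega)) (stirlingSecond_ne_zero (by omega) (by omega))
  · have h1 : Differentiable ℝ (c (d + 1) (j + 1) 0 0) := (hcd _ _ _ _).differentiable (by simp)
    have h2 : Differentiable ℝ (dU^[j + 1] g) :=
      (contDiff_iterate_dU (n := 1) (hg'.of_le (by norm_cast; omega))).differentiable (by simp)
    refine contDiff_of_dUbar_eq_zero (h1.sub h2) ?_ _
    rw [dUbar_sub h1 h2, hc.dUbar_coeff hg' ha hb hj,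
      dUbar_iterate_dU (hg'.of_le (by norm_cast; omega)), sub_self]
  · have h1 : Differentiable ℝ (c 0 0 (d + 1) (k + 1)) := (hcd _ _ _ _).differentiable (by simp)
    have h2 : Differentiable ℝ (dUbar^[k + 1] g) :=
      (contDiff_iterate_dUbar (n := 1) (hg'.of_le (by norm_cast; omega))).differentiable (by simp)
    refine contDiff_of_dU_eq_zero (h1.sub h2) ?_ _
    rw [dU_sub h1 h2, hc.dU_coeff_zero hk, dU_iterate_dUbar (hg'.of_le (by norm_cast; omega)), ha,
      sub_self]

end Determining

/-! ## Principal parts -/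

/-- Each term of `shift` replaces one factor `X r` by `X (r + 1)`, so the number of factors is
unchanged. -/
theorem isHomogeneous_shift {P : MvPolynomial ℕ ℂ} {j : ℕ} (hP : P.IsHomogeneous j) :
    (shift P).IsHomogeneous j := by
  rw [P.as_sum, map_sum]
  refine MvPolynomial.IsHomogeneous.sum _ _ _ fun s hs => ?_
  have hs' : s.degree = j := by
    by_contra h
    exact MvPolynomial.mem_support_iff.1 hs (hP.coeff_eq_zero h)
  rw [shift, MvPolynomial.mkDerivation_monomial, Finsupp.sum, Finset.smul_sum]
  refine MvPolynomial.IsHomogeneous.sum _ _ _ fun i hi => ?_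
  rw [MvPolynomial.smul_eq_C_mul, smul_eq_mul]
  have h1 : (s - Finsupp.single i 1).degree + 1 = j := by
    have h2 : Finsupp.single i 1 ≤ s := by
      simpa [Nat.one_le_iff_ne_zero] using hi
    have h3 := congrArg Finsupp.degree (tsub_add_cancel_of_le h2)
    rw [map_add, Finsupp.degree_single, hs'] at h3
    exact h3
  rw [← zero_add j, ← h1]
  exact (MvPolynomial.isHomogeneous_C _ _).mul
    ((MvPolynomial.isHomogeneous_monomial _ rfl).mul (MvPolynomial.isHomogeneous_X _ _))

theorem isHomogeneous_bell (n j : ℕ) : (bell n j).IsHomogeneous j := by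
  induction n generalizing j with
  | zero =>
    rcases j with _ | j
    · exact MvPolynomial.isHomogeneous_one _ _
    · exact MvPolynomial.isHomogeneous_zero _ _ _
  | succ n ih =>
    rcases j with _ | j
    · exact isHomogeneous_shift (ih 0)
    · refine (isHomogeneous_shift (ih (j + 1))).add ?_
      rw [add_comm j]
      exact (MvPolynomial.isHomogeneous_X _ _).mul (ih j)

/-- The bidegree in the derivatives of `u` and of `ū`. -/
def biweight : ℕ ⊕ ℕ → ℕ × ℕ := Sum.elim (fun _ => (1, 0)) (fun _ => (0, 1))

theorem isWeightedHomogeneous_aeval {P : MvPolynomial ℕ ℂ} {j : ℕ} (hP : P.IsHomogeneous j)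
    (ι : ℕ → ℕ ⊕ ℕ) (v : ℕ × ℕ) (hι : ∀ r, biweight (ι r) = v) :
    MvPolynomial.IsWeightedHomogeneous biweight
      (MvPolynomial.aeval (fun r => (MvPolynomial.X (ι r) : DiffPoly)) P) (j • v) := by
  rw [MvPolynomial.aeval_def, MvPolynomial.eval₂_eq]
  refine MvPolynomial.IsWeightedHomogeneous.sum _ _ _ fun s hs => ?_
  have hs' : s.degree = j := by
    by_contra h
    exact MvPolynomial.mem_support_iff.1 hs (hP.coeff_eq_zero h)
  rw [← hs', ← zero_add (s.degree • v), Finsupp.degree_apply, Finset.sum_smul]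
  refine MvPolynomial.IsWeightedHomogeneous.mul ?_
    (MvPolynomial.IsWeightedHomogeneous.prod _ _ _ fun i _ => ?_)
  · exact MvPolynomial.isWeightedHomogeneous_C _ _
  · rw [← hι i]
    exact (MvPolynomial.isWeightedHomogeneous_X _ _ _).pow _

theorem isWeightedHomogeneous_term (c : ℂ → ℂ) (n j m k : ℕ) :
    MvPolynomial.IsWeightedHomogeneous biweight
      (MvPolynomial.C c * bellU n j * bellUbar m k) (j, k) := by
  have h1 := isWeightedHomogeneous_aeval (isHomogeneous_bell n j) Sum.inl (1, 0) fun _ => rfl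
  have h2 := isWeightedHomogeneous_aeval (isHomogeneous_bell m k) Sum.inr (0, 1) fun _ => rfl
  have := ((MvPolynomial.isWeightedHomogeneous_C biweight c).mul h1).mul h2
  simpa [bellU, bellUbar] using this

theorem weight_principalExponent (n m : ℕ) : Finsupp.weight biweight (principalExponent n m) =
    (if n = 0 then 0 else 1, if m = 0 then 0 else 1) := by
  unfold principalExponent
  by_cases hn : n = 0 <;> by_cases hm : m = 0 <;>
    simp [hn, hm, Finsupp.weight_single, biweight, Prod.ext_iff]

/-! ### Splitting off the current `V` and the residual -/

theorem bellU_succ_zero (n : ℕ) : bellU (n + 1) 0 = 0 := by simp [bellU, bell_succ_zero]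

theorem bellUbar_succ_zero (n : ℕ) : bellUbar (n + 1) 0 = 0 := by simp [bellUbar, bell_succ_zero]

theorem V_succ (d : ℕ) (g : ℂ → ℂ) : V (d + 1) g = ∑ n ∈ Finset.range (d + 1),
    ∑ j ∈ Finset.range (n + 1), ∑ k ∈ Finset.range (d - n + 1),
      MvPolynomial.C (((-1 : ℂ) ^ (d - n)) • dU^[j] (dUbar^[k] g)) * bellU n j *
        bellUbar (d - n) k := by
  have e : ∀ (m : ℕ) (h : ℂ → ℂ), (MvPolynomial.C (((-1 : ℂ) ^ m) • h) : DiffPoly) =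
      (-1) ^ m * MvPolynomial.C h := by
    intro m h
    rw [show ((-1 : ℂ) ^ m) • h = (-1) ^ m * h by funext w; simp]
    simp
  rw [V, ← Finset.sum_range_reflect]
  refine Finset.sum_congr rfl fun n hn => ?_
  simp only [Finset.mem_range] at hn
  simp only [normalOrdered, e, Finset.mul_sum, mul_assoc]
  rw [show d + 1 - 1 - n = d - n by omega, show d + 1 - 1 - (d - n) = n by omega]

/-- The coefficients of the part of a conserved current that is left when its characteristic
current `V_{d+1}(g)` is removed. -/
def residualCoeff (d : ℕ) (f : ℕ → ℕ → ℕ → ℕ → ℂ → ℂ) (g : ℂ → ℂ) (n j m k : ℕ) : ℂ → ℂ :=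
  if 1 ≤ j ∧ j ≤ d ∧ n = d ∧ m = 0 ∧ k = 0 then f d j 0 0 - dU^[j] g
  else if 1 ≤ k ∧ k ≤ d ∧ n = 0 ∧ m = d ∧ j = 0 then f 0 0 d k - ((-1 : ℂ) ^ d) • dUbar^[k] g
  else 0

/-- Termwise comparison: interior terms agree with `V` by `h`, and edge terms agree by the
definition of `residualCoeff`. Terms with `j = 0 < n` or `k = 0 < m` contain a zero Bell polynomial.
-/
theorem eq_V_add_residual {d : ℕ} {f : ℕ → ℕ → ℕ → ℕ → ℂ → ℂ} {g : ℂ → ℂ}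
    (h : ∀ m l, m + 1 + (l + 1) = d + 1 → ∀ j ≤ m, ∀ k ≤ l,
      f (m + 1) (j + 1) (l + 1) (k + 1) = ((-1 : ℂ) ^ (l + 1)) • dU^[j + 1] (dUbar^[k + 1] g)) :
    ∑ n ∈ Finset.range (d + 1 + 1),
      ∑ j ∈ Finset.range (n + 1), ∑ k ∈ Finset.range (d + 1 - n + 1),
        MvPolynomial.C (f n j (d + 1 - n) k) * bellU n j * bellUbar (d + 1 - n) k =
    V (d + 1 + 1) g + ∑ n ∈ Finset.range (d + 1 + 1),
      ∑ j ∈ Finset.range (n + 1), ∑ k ∈ Finset.range (d + 1 - n + 1),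
        MvPolynomial.C (residualCoeff (d + 1) f g n j (d + 1 - n) k) * bellU n j *
          bellUbar (d + 1 - n) k := by
  rw [V_succ]
  simp only [← Finset.sum_add_distrib]
  refine Finset.sum_congr rfl fun n hn => Finset.sum_congr rfl fun j hj =>
    Finset.sum_congr rfl fun k hk => ?_
  simp only [Finset.mem_range] at hn hj hk
  rw [← add_mul, ← add_mul, ← MvPolynomial.C_add]
  obtain ⟨m, hm⟩ : ∃ m, d + 1 - n = m := ⟨_, rfl⟩
  rw [hm] at hk ⊢
  rcases n with _ | n
  · obtain rfl : j = 0 := by omega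
    obtain rfl : m = d + 1 := by omega
    rcases k with _ | k
    · simp [bellUbar_succ_zero]
    · rw [residualCoeff, if_neg (by omega), if_pos (by omega)]
      simp
  · rcases j with _ | j
    · simp [bellU_succ_zero]
    rcases m with _ | m
    · obtain rfl : k = 0 := by omega
      obtain rfl : n = d := by omega
      rw [residualCoeff, if_pos (by omega)]
      simp
    · rcases k with _ | k
      · simp [bellUbar_succ_zero]
      rw [residualCoeff, if_neg (by omega), if_neg (by omega), h n m (by omega) j (by omega) k (by omega),
        add_zero]

theorem hasNoPrincipalPart_residual {d : ℕ} {f : ℕ → ℕ → ℕ → ℕ → ℂ → ℂ} {g : ℂ → ℂ}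
    (h1 : f (d + 1) 1 0 0 = dU g) (h2 : f 0 0 (d + 1) 1 = ((-1 : ℂ) ^ (d + 1)) • dUbar g) :
    HasNoPrincipalPart (d + 1 + 1) (∑ n ∈ Finset.range (d + 1 + 1),
      ∑ j ∈ Finset.range (n + 1), ∑ k ∈ Finset.range (d + 1 - n + 1),
        MvPolynomial.C (residualCoeff (d + 1) f g n j (d + 1 - n) k) * bellU n j *
          bellUbar (d + 1 - n) k) := by
  intro N hN
  rw [MvPolynomial.coeff_sum]
  refine Finset.sum_eq_zero fun n hn => ?_
  rw [MvPolynomial.coeff_sum]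
  refine Finset.sum_eq_zero fun j hj => ?_
  rw [MvPolynomial.coeff_sum]
  refine Finset.sum_eq_zero fun k hk => ?_
  -- A term of bidegree `(j, k)` meets a principal monomial only if `j, k ≤ 1`, and the residual
  -- coefficients of such terms vanish by `h1` and `h2`.
  by_cases hw : Finsupp.weight biweight (principalExponent N (d + 1 + 1 - 1 - N)) = (j, k)
  · have hr : residualCoeff (d + 1) f g n j (d + 1 - n) k = 0 := by
      rw [weight_principalExponent, Prod.mk.injEq] at hw
      unfold residualCoeff
      split_ifs with hA hB
      · obtain rfl : j = 1 := by
          have := hw.1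
          split_ifs at this <;> omega
        rw [h1]
        simp
      · obtain rfl : k = 1 := by
          have := hw.2
          split_ifs at this <;> omega
        rw [h2]
        simp
      · rfl
    simp [hr]
  · exact (isWeightedHomogeneous_term _ n j _ k).coeff_eq_zero _ hw

theorem eq_zero_of_hasNoPrincipalPart_two {K : DiffPoly} (hK : IsHomogeneousDiffPoly 2 1 K)
    (h : HasNoPrincipalPart 2 K) : K = 0 := by
  obtain ⟨f, -, rfl⟩ := hK
  have hb : bell 1 1 = MvPolynomial.X 1 := by simp [bell]
  have e0 : bellU 0 0 = 1 := by simp [bellU, bell]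
  have e0' : bellUbar 0 0 = 1 := by simp [bellUbar, bell]
  have e1 : bellU 1 1 = MvPolynomial.X (Sum.inl 1) := by simp [bellU, hb]
  have e1' : bellUbar 1 1 = MvPolynomial.X (Sum.inr 1) := by simp [bellUbar, hb]
  have eK : (∑ n ∈ Finset.range (1 + 1),
      ∑ j ∈ Finset.range (n + 1), ∑ k ∈ Finset.range (1 - n + 1),
        MvPolynomial.C (f n j (1 - n) k) * bellU n j * bellUbar (1 - n) k) =
      MvPolynomial.C (f 0 0 1 1) * MvPolynomial.X (Sum.inr 1) +
        MvPolynomial.C (f 1 1 0 0) * MvPolynomial.X (Sum.inl 1) := by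
    simp [Finset.sum_range_succ, e0, e0', e1, e1', bellU_succ_zero 0, bellUbar_succ_zero 0]
  rw [eK] at h ⊢
  have h0 := h 0 (by omega)
  have h1 := h 1 (by omega)
  simp only [principalExponent, MvPolynomial.coeff_add, MvPolynomial.coeff_C_mul,
    MvPolynomial.coeff_X] at h0 h1
  simp [Finsupp.single_eq_single_iff] at h0 h1
  simp [h0, h1]

end PSubmodel
end

theorem mainTheorem9 (n p : ℕ) (hp : 2 ≤ p) (hn : 2 ≤ n ∨ (n = 1 ∧ Odd p))
    (U : Set (PSubmodel.Mink n)) (hU : IsOpen U) (hU' : U.Nonempty)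
    (J : PSubmodel.DiffPoly) (hJ : PSubmodel.IsHomogeneousDiffPoly p (p - 1) J) :
    (PSubmodel.IsConservedCurrent p U J ↔
      ∃ (f : ℂ → ℂ) (K : PSubmodel.DiffPoly),
        ContDiff ℝ p f ∧
        PSubmodel.IsHomogeneousDiffPoly p (p - 1) K ∧
        PSubmodel.IsConservedCurrent p U K ∧
        PSubmodel.HasNoPrincipalPart p K ∧
        J = PSubmodel.V p f + K) ∧
    (p = 2 → ∀ K : PSubmodel.DiffPoly,
      PSubmodel.IsHomogeneousDiffPoly p (p - 1) K →
      PSubmodel.IsConservedCurrent p U K →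
      PSubmodel.HasNoPrincipalPart p K → K = 0) := by
  open PSubmodel in
  refine ⟨⟨fun hcons => ?_, ?_⟩, ?_⟩
  · obtain ⟨d, rfl⟩ := Nat.exists_eq_add_of_le' hp
    have hJ' := hJ
    obtain ⟨f, hf, hJf⟩ := hJ'
    rw [show d + 2 - 1 = d + 1 by omega] at hJf
    rw [hJf] at hcons
    have hfd : ∀ n j m k, Differentiable ℝ (f n j m k) := fun n j m k =>
      (hf n j m k).differentiable (by simp)
    -- The two sides involve `ū`-orders `l + 1` and `l`, so the factor `(-1)^m` turns the vanishing
    -- sum into an equality.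
    have hdet : Determining (d + 1) (fun n j m k => ((-1 : ℂ) ^ m) • f n j m k) := by
      intro m l hml j hj k hk w
      have h := hcons.determining_equation hp hn hU' hfd hml hj hk w
      simp only [dU_const_smul, dUbar_const_smul, Pi.smul_apply, smul_eq_mul]
      linear_combination (-1) ^ (l + 1) * h
    obtain ⟨g, hg, ha, hb, hmid, hol, ahol⟩ := hdet.exists_potential fun n j m k =>
      contDiff_const.smul (hf n j m k)
    have sq : ∀ m : ℕ, ((-1 : ℂ) ^ m) * (-1) ^ m = 1 := fun m => by rw [← mul_pow]; simp
    have hmid' : ∀ m l, m + 1 + (l + 1) = d + 1 → ∀ j ≤ m, ∀ k ≤ l,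
        f (m + 1) (j + 1) (l + 1) (k + 1) =
          ((-1 : ℂ) ^ (l + 1)) • dU^[j + 1] (dUbar^[k + 1] g) := fun m l hml j hj k hk => by
      rw [← hmid m l hml j hj k hk, smul_smul, sq, one_smul]
    have hdec := eq_V_add_residual hmid'
    have hK : IsHomogeneousDiffPoly (d + 2) (d + 2 - 1) (∑ n ∈ Finset.range (d + 1 + 1),
        ∑ j ∈ Finset.range (n + 1), ∑ k ∈ Finset.range (d + 1 - n + 1),
        MvPolynomial.C (residualCoeff (d + 1) f g n j (d + 1 - n) k) * bellU n j *
          bellUbar (d + 1 - n) k) := by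
      refine ⟨residualCoeff (d + 1) f g, fun n j m k => ?_, rfl⟩
      unfold residualCoeff
      split_ifs with h1 h2
      · obtain ⟨j, rfl⟩ := Nat.exists_eq_add_of_le' h1.1
        simpa using hol j (by omega)
      · obtain ⟨k, rfl⟩ := Nat.exists_eq_add_of_le' h2.1
        have : ContDiff ℝ (d + 2 : ℕ) (((-1 : ℂ) ^ (d + 1)) •
            (((-1 : ℂ) ^ (d + 1)) • f 0 0 (d + 1) (k + 1) - dUbar^[k + 1] g)) :=
          (ahol k (by omega)).const_smul ((-1 : ℂ) ^ (d + 1))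
        rwa [smul_sub, smul_smul, sq, one_smul] at this
      · exact contDiff_const
    refine ⟨g, _, hg, hK, ?_, hasNoPrincipalPart_residual (by simpa using ha.symm)
      (by rw [hb, smul_smul, sq, one_smul]), hJf.trans hdec⟩
    -- The residual is `J - V g`, a difference of two conserved currents.
    have hsub := isConservedCurrent_sub (U := U)
      (fun u hu x hx μ => hJ.differentiableAt hU hu hx (by omega))
      (fun u hu x hx μ => (hasPD_evalAt_V hU hu hx hg).1) (hJf ▸ hcons)
      (isConservedCurrent_V hU (by omega) hg)
    rwa [hJf.trans hdec, add_sub_cancel_left] at hsub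
  · rintro ⟨f, K, hf, hK, hKc, -, rfl⟩
    exact isConservedCurrent_add
      (fun u hu x hx μ => (hasPD_evalAt_V hU hu hx hf).1)
      (fun u hu x hx μ => hK.differentiableAt hU hu hx (by omega))
      (isConservedCurrent_V hU (by omega) hf) hKc
  · rintro rfl K hK - hKp
    exact eq_zero_of_hasNoPrincipalPart_two hK hKp
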